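/- Let $M$ be a smooth (Hausdorff, second countable, finite-dimensional) manifold without boundary, equipped with a smooth positive density $\mathrm{d}x$ (for instance the volume density of a Lorentzian or Riemannian metric), and let $E\to M$ be a smooth complex vector bundle of finite rank with a smooth hermitian fibre metric $\langle\cdot,\cdot\rangle$, conjugate-linear in the first argument, nondegenerate but not necessarily positive definite. A smooth kernel is a section $k\in C^\infty(M\times M;E\boxtimes E^*)$, i.e. a smooth family of linear maps $k(x,y):E_y\to E_x$. It is called self-adjoint if $k(x,y)^*=k(y,x)$ for all $x,y$, the adjoint being taken with respect to the hermitian metric; it is called properly supported if both projections $\operatorname{supp}k\to M$ are proper; and one writes $k\ge 0$ if $$\int_{M\times M}\langle u(x),k(x,y)\,u(y)\rangle\,\mathrm{d}x\,\mathrm{d}y\ \ge\ 0\qquad\text{for all } u\in C_0^\infty(M;E).$$ Let $k\in C^\infty(M\times M;E\boxtimes E^*)$ be self-adjoint. Then there is a kernel $K\in C^\infty(M\times M;E\boxtimes E^*)$ such that (i) $K\ge 0$; (ii) $K-k\ge 0$; (iii) if $k$ is properly supported, then $K$ is properly supported. If moreover $E$ is equipped with a complex conjugation, that is, a smooth fibrewise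 conjugate-linear involution $v\mapsto\overline v$ of $E$ with $\langle\overline v,\overline w\rangle=\langle w,v\rangle$, then $K$ can be chosen such that, in addition to (i)–(iii), (iv) $K$ is real: $\overline{K(x,y)\,\overline{v}}=K(x,y)\,v$ for all $x,y\in M$ and $v\in E_y$. -/

import Mathlib

open scoped Manifold ContDiff Bundle ComplexConjugate ComplexOrder
open Bundle MeasureTheory

noncomputable section

/-- A complex vector bundle is in particular a real vector bundle. (Mathlib's smooth vector bundles
have the same scalar field as the base manifold, so smoothness of a complex vector bundle over a
real manifold is smoothness of its real transition functions.) -/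
instance complexVectorBundle_toReal {B : Type*} [TopologicalSpace B]
    {F : Type*} [NormedAddCommGroup F] [NormedSpace ℂ F]
    {E : B → Type*} [∀ x, AddCommGroup (E x)] [∀ x, Module ℂ (E x)]
    [TopologicalSpace (TotalSpace F E)] [∀ x, TopologicalSpace (E x)]
    [FiberBundle F E] [VectorBundle ℂ F E] : VectorBundle ℝ F E := by
  have hlin : ∀ (e : Trivialization F (π F E)) [MemTrivializationAtlas e], e.IsLinear ℝ := by
    intro e _
    refine ⟨fun b hb => ⟨(e.linear ℂ hb).map_add, fun c v => ?_⟩⟩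
    exact (e.linear ℂ hb).map_smul (c : ℂ) v
  refine ⟨hlin, fun e e' _ _ => ?_⟩
  have h1 := continuousOn_coordChange ℂ e e'
  have h2 : ContinuousOn (fun b => ContinuousLinearMap.restrictScalarsL ℂ F F ℝ ℝ
      (Trivialization.coordChangeL ℂ e e' b : F →L[ℂ] F)) (e.baseSet ∩ e'.baseSet) :=
    (ContinuousLinearMap.restrictScalarsL ℂ F F ℝ ℝ).continuous.comp_continuousOn h1
  have := hlin e
  have := hlin e'
  refine h2.congr fun b hb => ?_
  ext v
  have a1 := Trivialization.coordChangeL_apply (R := ℝ) e e' hb v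
  have a2 := Trivialization.coordChangeL_apply (R := ℂ) e e' hb v
  exact a1.trans a2.symm

section

variable {d : ℕ} {M : Type*} [TopologicalSpace M] [ChartedSpace (EuclideanSpace ℝ (Fin d)) M]

/-- A measure on a smooth `d`-manifold is a smooth positive density if in every chart it has a
smooth strictly positive density with respect to Lebesgue measure. -/
def IsSmoothPositiveDensity (d : ℕ) {M : Type*} [TopologicalSpace M]
    [ChartedSpace (EuclideanSpace ℝ (Fin d)) M] [MeasurableSpace M] (μ : Measure M) : Prop :=
  ∀ φ ∈ atlas (EuclideanSpace ℝ (Fin d)) M, ∃ ρ : EuclideanSpace ℝ (Fin d) → ℝ,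
    ContDiffOn ℝ ∞ ρ φ.target ∧ (∀ z ∈ φ.target, 0 < ρ z) ∧
      ∀ A ⊆ φ.source, MeasurableSet A → μ A = ∫⁻ z in φ '' A, ENNReal.ofReal (ρ z)

variable {F : Type*} [NormedAddCommGroup F] [NormedSpace ℂ F]
  {E : M → Type*} [∀ x, AddCommGroup (E x)] [∀ x, Module ℂ (E x)]
  [TopologicalSpace (TotalSpace F E)] [∀ x, TopologicalSpace (E x)]
  [FiberBundle F E]

/-- A smooth hermitian fibre metric, conjugate-linear in the first argument, nondegenerate but not
necessarily positive definite. Smoothness is that of its coefficients in local trivializations. -/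
structure HermitianBundleMetric (d : ℕ) {M : Type*} [TopologicalSpace M]
    [ChartedSpace (EuclideanSpace ℝ (Fin d)) M]
    (F : Type*) [NormedAddCommGroup F] [NormedSpace ℂ F]
    (E : M → Type*) [∀ x, AddCommGroup (E x)] [∀ x, Module ℂ (E x)]
    [TopologicalSpace (TotalSpace F E)] [∀ x, TopologicalSpace (E x)] [FiberBundle F E] where
  form : ∀ x, E x →ₗ⋆[ℂ] E x →ₗ[ℂ] ℂ
  hermitian : ∀ x (v w : E x), conj (form x v w) = form x w v
  nondegenerate : ∀ x (v : E x), (∀ w, form x v w = 0) → v = 0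
  smooth : ∀ (x₀ : M) (a b : F),
    ContMDiffOn (𝓡 d) 𝓘(ℝ, ℂ) ∞
      (fun x => form x ((trivializationAt F E x₀).symm x a) ((trivializationAt F E x₀).symm x b))
      (trivializationAt F E x₀).baseSet

/-- A complex conjugation on a hermitian vector bundle: a smooth fibrewise conjugate-linear
involution that is compatible with the fibre metric, `⟨v̄, w̄⟩ = ⟨w, v⟩`. -/
structure ComplexConjugation (h : HermitianBundleMetric d F E) where
  toMap : ∀ x, E x →ₗ⋆[ℂ] E x
  involutive : ∀ x (v : E x), toMap x (toMap x v) = v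
  compatible : ∀ x (v w : E x), h.form x (toMap x v) (toMap x w) = h.form x w v
  smooth : ContMDiff ((𝓡 d).prod 𝓘(ℝ, F)) ((𝓡 d).prod 𝓘(ℝ, F)) ∞
    (fun p : TotalSpace F E => TotalSpace.mk' F p.proj (toMap p.proj p.snd))

/-- A section `(x, y) ↦ k x y` of `E ⊠ E*` over `M × M`, where `(E ⊠ E*)_(x, y) = Hom(E_y, E_x)`. -/
abbrev BundleKernel {M : Type*} (E : M → Type*) [∀ x, AddCommGroup (E x)] [∀ x, Module ℂ (E x)] :=
  ∀ x y : M, E y →ₗ[ℂ] E x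

/-- The kernel is smooth on `M × M`: its coefficients in local trivializations of `E` around `x₀`
and `y₀` are smooth functions of `(x, y)`. -/
def IsSmoothKernel (d : ℕ) {M : Type*} [TopologicalSpace M]
    [ChartedSpace (EuclideanSpace ℝ (Fin d)) M]
    (F : Type*) [NormedAddCommGroup F] [NormedSpace ℂ F]
    {E : M → Type*} [∀ x, AddCommGroup (E x)] [∀ x, Module ℂ (E x)]
    [TopologicalSpace (TotalSpace F E)] [∀ x, TopologicalSpace (E x)] [FiberBundle F E]
    (k : BundleKernel E) : Prop :=
  ∀ (x₀ y₀ : M) (a : F),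
    ContMDiffOn ((𝓡 d).prod (𝓡 d)) 𝓘(ℝ, F) ∞
      (fun p : M × M => (trivializationAt F E x₀
        ⟨p.1, k p.1 p.2 ((trivializationAt F E y₀).symm p.2 a)⟩).2)
      ((trivializationAt F E x₀).baseSet ×ˢ (trivializationAt F E y₀).baseSet)

/-- `k(x, y)* = k(y, x)`, the adjoint being taken with respect to the fibre metric. -/
def IsSelfAdjointKernel (h : HermitianBundleMetric d F E) (k : BundleKernel E) : Prop :=
  ∀ (x y : M) (v : E y) (w : E x), h.form x (k x y v) w = h.form y v (k y x w)

/-- `k ≥ 0`: for every smooth compactly supported section `u` of `E`,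
`∫_(M × M) ⟨u(x), k(x, y) u(y)⟩ dx dy ≥ 0` (that is, the integral is real and nonnegative). -/
def IsNonnegKernel [MeasurableSpace M] (μ : Measure M) (h : HermitianBundleMetric d F E)
    (k : BundleKernel E) : Prop :=
  ∀ u : ∀ x, E x,
    ContMDiff (𝓡 d) ((𝓡 d).prod 𝓘(ℝ, F)) ∞ (fun x => TotalSpace.mk' F x (u x)) →
    IsCompact (closure {x | u x ≠ 0}) →
    0 ≤ ∫ p : M × M, h.form p.1 (u p.1) (k p.1 p.2 (u p.2)) ∂(μ.prod μ)

/-- The support of a kernel, a closed subset of `M × M`. -/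
def kernelSupport (k : BundleKernel E) : Set (M × M) :=
  closure {p : M × M | k p.1 p.2 ≠ 0}

/-- The two projections `supp k → M` are proper. -/
def IsProperlySupported (k : BundleKernel E) : Prop :=
  ∀ C : Set M, IsCompact C →
    IsCompact (kernelSupport k ∩ Prod.fst ⁻¹' C) ∧ IsCompact (kernelSupport k ∩ Prod.snd ⁻¹' C)

/-- The kernel is real: the conjugate of `K(x, y) v̄` is `K(x, y) v`. -/
def IsRealKernel {h : HermitianBundleMetric d F E} (c : ComplexConjugation h)
    (K : BundleKernel E) : Prop :=
  ∀ (x y : M) (v : E y), c.toMap x (K x y (c.toMap y v)) = K x y v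

end

end

noncomputable section

universe u

/-! ### Weighted Schur test for matrices of measures -/

section DominatingMeasures

open scoped ENNReal

/-! The idea is to bound the quadratic form of `k` in absolute value by a diagonal form that is
visibly a superposition of squares on the Fourier side.

By `HermitianBundleMetric.exists_dual_frames` a test section is u = ∑ U_a f_a with U_a = ⟨e_a, u⟩,
where e_a and f_a live on a compact set T_a inside a chart φ_a and the T_a are locally finite. The
form of `k` becomes a double sum of conj(U_a(x)) U_b(y) Φ_ab(φ_a x, φ_b y) with Φ_ab smooth and
compactly supported. Writing Φ_ab as a Fourier integral turns each term into an integral of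
conj(Û_a(η₁)) Û_b(-η₂) against a rapidly decreasing density.

A weighted arithmetic-geometric inequality then removes the off-diagonal terms:
`exists_dominating_measures` bounds the double sum by ∑_a ∫ |Û_a|² dν_a. The weights can be chosen
so that every ν_a has finite moments of all orders, although infinitely many b contribute to it.
Hence G_a(z) = ∫ exp(2πi⟨ξ, z⟩) dν_a is smooth, and ∫ |Û_a|² dν_a is the form of G_a(φ_a x - φ_a y).
This is `exists_dominating_functions`.

The kernel K(x, y) = ∑ G_a(φ_a x - φ_a y) e_a(x) ⟨e_a(y), ·⟩ therefore has a nonnegative form that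
dominates the absolute value of the form of `k`, which is real by self-adjointness
(`exists_dominating_kernel`). Its support lies in the union of the T_a × T_a, so both projections
are proper. Since only the scalars U_a enter, the signature of the fibre metric plays no role. For a
real kernel one adds to K its conjugate, which is again nonnegative. -/

theorem ENNReal.exists_weights_tsum_ne_top {A N : Type*} [Countable A] [Countable N]
    (s : N → A → ℝ≥0∞) (hs : ∀ n a, s n a ≠ ⊤) :
    ∃ τ : A → ℝ≥0∞, (∀ a, τ a ≠ 0 ∧ τ a ≠ ⊤) ∧ ∀ n, ∑' a, τ a * s n a ≠ ⊤ := by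
  obtain hN | hN := isEmpty_or_nonempty N
  · exact ⟨fun _ => 1, fun a => by simp, fun n => (hN.false n).elim⟩
  obtain ⟨g, hg⟩ := exists_surjective_nat N
  obtain ⟨f, hf⟩ := Countable.exists_injective_nat A
  obtain ⟨δ, hδ, hδs⟩ := ENNReal.exists_pos_sum_of_countable (one_ne_zero (α := ℝ≥0∞)) A
  -- Diagonal argument: the weight at `a` beats the first `f a + 1` rows at once, so each fixed row
  -- is controlled by the summable `δ` at all but finitely many `a`. The summand 1 keeps the
  -- denominator nonzero.
  set C : A → ℝ≥0∞ := fun a => 1 + ∑ k ∈ Finset.range (f a + 1), s (g k) a with hC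
  have hC0 : ∀ a, C a ≠ 0 := fun a => by simp [hC]
  have hCt : ∀ a, C a ≠ ⊤ := fun a => by simp [hC, hs]
  refine ⟨fun a => δ a / C a, fun a => ⟨?_, ?_⟩, fun n => ?_⟩
  · simp [ENNReal.div_eq_zero_iff, hCt, (hδ a).ne']
  · simp [ENNReal.div_eq_top, hC0]
  obtain ⟨k, rfl⟩ := hg n
  set T : A → ℝ≥0∞ := fun a => δ a / C a * s (g k) a with hT
  have hfin : {a | f a < k}.Finite := (Set.finite_Iio k).preimage hf.injOn
  have hle : ∀ a, T a ≤ δ a + {a | f a < k}.indicator T a := by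
    intro a
    by_cases ha : f a < k
    · rw [Set.indicator_of_mem (show a ∈ {a | f a < k} from ha)]
      exact le_add_self
    · refine le_trans ?_ le_self_add
      have h1 : s (g k) a ≤ C a := by
        refine le_trans ?_ le_add_self
        exact Finset.single_le_sum (f := fun k => s (g k) a) (fun _ _ => zero_le)
          (Finset.mem_range.2 (by omega))
      calc T a ≤ δ a / C a * C a := by simp only [hT]; gcongr
        _ = δ a := ENNReal.div_mul_cancel (hC0 a) (hCt a)
  refine ne_top_of_le_ne_top ?_ (ENNReal.tsum_le_tsum hle)
  rw [ENNReal.tsum_add]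
  refine ENNReal.add_ne_top.2 ⟨(hδs.trans ENNReal.one_lt_top).ne, ?_⟩
  rw [← tsum_subtype]
  have := hfin.fintype
  rw [tsum_fintype]
  refine ENNReal.sum_ne_top.2 fun a _ => ENNReal.mul_ne_top ?_ (hs _ _)
  simp [ENNReal.div_eq_top, hC0]

/-- According to which of `y` and `t * x` is larger, one of the two terms on the right already
suffices; this needs no square roots or subtraction and allows infinite values. -/
theorem ENNReal.mul_le_weighted_sq_add_sq {t : ℝ≥0∞} (h0 : t ≠ 0) (ht : t ≠ ⊤) (x y : ℝ≥0∞) :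
    x * y ≤ t * x ^ 2 + t⁻¹ * y ^ 2 := by
  rcases le_total y (t * x) with h | h
  · refine le_trans ?_ le_self_add
    calc x * y ≤ x * (t * x) := by gcongr
      _ = t * x ^ 2 := by ring
  · refine le_trans ?_ le_add_self
    have : x ≤ t⁻¹ * y := by
      calc x = t⁻¹ * (t * x) := by rw [← mul_assoc, ENNReal.inv_mul_cancel h0 ht, one_mul]
        _ ≤ _ := by gcongr
    calc x * y ≤ (t⁻¹ * y) * y := by gcongr
      _ = t⁻¹ * y ^ 2 := by ring

/-- A weighted Schur test: a countable matrix of measures with finite moments is dominated by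
a diagonal matrix of measures with finite moments. -/
theorem exists_dominating_measures {A V W : Type*} [Countable A] [NormedAddCommGroup V]
    [MeasurableSpace V] [BorelSpace V] [MeasurableSpace W] (m : A → A → Measure W)
    (p q : W → V) (hp : Measurable p) (hq : Measurable q)
    (hmp : ∀ a b (n : ℕ), ∫⁻ η, ‖p η‖ₑ ^ n ∂m a b ≠ ⊤)
    (hmq : ∀ a b (n : ℕ), ∫⁻ η, ‖q η‖ₑ ^ n ∂m a b ≠ ⊤) :
    ∃ ν : A → Measure V, (∀ a (n : ℕ), ∫⁻ ξ, ‖ξ‖ₑ ^ n ∂ν a ≠ ⊤) ∧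
      ∀ (s : Finset A) (f : A → V → ℝ≥0∞), (∀ a, Measurable (f a)) →
        ∑ a ∈ s, ∑ b ∈ s, ∫⁻ η, f a (p η) * f b (q η) ∂m a b ≤ ∑ a ∈ s, ∫⁻ ξ, f a ξ ^ 2 ∂ν a := by
  -- The conditions are indexed by a row together with a moment order. Row and column moments enter
  -- jointly because `ν a` collects both.
  obtain ⟨τ, hτ, hsum⟩ := ENNReal.exists_weights_tsum_ne_top
    (fun (i : A × ℕ) (b : A) =>
      ∫⁻ η, ‖p η‖ₑ ^ i.2 ∂m i.1 b + ∫⁻ η, ‖q η‖ₑ ^ i.2 ∂m b i.1)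
    (fun i b => ENNReal.add_ne_top.2 ⟨hmp _ _ _, hmq _ _ _⟩)
  -- The inequality for the pair `(a, b)` is used with parameter `τ b / τ a`, whose inverse is the
  -- same expression with the roles exchanged. After relabelling, both terms thus carry the same
  -- weight.
  set ν : A → Measure V := fun a => Measure.sum fun b =>
    (τ b / τ a) • ((m a b).map p + (m b a).map q) with hν
  have hint : ∀ a (f : V → ℝ≥0∞), Measurable f → ∫⁻ ξ, f ξ ∂ν a =
      ∑' b, (τ b / τ a) * (∫⁻ η, f (p η) ∂m a b + ∫⁻ η, f (q η) ∂m b a) := by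
    intro a f hf
    simp only [hν, lintegral_sum_measure, lintegral_smul_measure, lintegral_add_measure,
      lintegral_map hf hp, lintegral_map hf hq, smul_eq_mul]
  have ht0 : ∀ a b, τ b / τ a ≠ 0 := fun a b => by
    simp [ENNReal.div_eq_zero_iff, (hτ b).1, (hτ a).2]
  have htt : ∀ a b, τ b / τ a ≠ ⊤ := fun a b => by
    simp [ENNReal.div_eq_top, (hτ b).2, (hτ a).1]
  refine ⟨ν, fun a n => ?_, fun s f hf => ?_⟩
  · rw [hint a _ (by fun_prop)]
    have := hsum (a, n)
    have h2 : ∀ b, τ b / τ a * (∫⁻ η, ‖p η‖ₑ ^ n ∂m a b + ∫⁻ η, ‖q η‖ₑ ^ n ∂m b a) =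
        (τ a)⁻¹ * (τ b * (∫⁻ η, ‖p η‖ₑ ^ n ∂m a b + ∫⁻ η, ‖q η‖ₑ ^ n ∂m b a)) := by
      intro b; rw [div_eq_mul_inv]; ring
    rw [tsum_congr h2, ENNReal.tsum_mul_left]
    exact ENNReal.mul_ne_top (ENNReal.inv_ne_top.2 (hτ a).1) this
  · calc ∑ a ∈ s, ∑ b ∈ s, ∫⁻ η, f a (p η) * f b (q η) ∂m a b
        ≤ ∑ a ∈ s, ∑ b ∈ s, ((τ b / τ a) * ∫⁻ η, f a (p η) ^ 2 ∂m a b +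
            (τ a / τ b) * ∫⁻ η, f b (q η) ^ 2 ∂m a b) := by
          refine Finset.sum_le_sum fun a _ => Finset.sum_le_sum fun b _ => ?_
          have h1 : Measurable fun η => f a (p η) := (hf a).comp hp
          have h2 : Measurable fun η => f b (q η) := (hf b).comp hq
          rw [← lintegral_const_mul _ (by fun_prop), ← lintegral_const_mul _ (by fun_prop),
            ← lintegral_add_left (by fun_prop)]
          refine lintegral_mono fun η => ?_
          have := ENNReal.mul_le_weighted_sq_add_sq (ht0 a b) (htt a b) (f a (p η)) (f b (q η))
          rwa [ENNReal.inv_div (Or.inl (hτ a).2) (Or.inl (hτ a).1)] at this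
      _ = ∑ a ∈ s, ∑ b ∈ s, (τ b / τ a) *
            (∫⁻ η, f a (p η) ^ 2 ∂m a b + ∫⁻ η, f a (q η) ^ 2 ∂m b a) := by
          simp only [mul_add, Finset.sum_add_distrib]
          congr 1
          rw [Finset.sum_comm]
      _ ≤ ∑ a ∈ s, ∫⁻ ξ, f a ξ ^ 2 ∂ν a := by
          refine Finset.sum_le_sum fun a _ => ?_
          rw [hint a _ ((hf a).pow_const 2)]
          exact ENNReal.sum_le_tsum s

end DominatingMeasures

/-! ### Fourier superpositions and domination in Euclidean space -/

section FourierRepresentation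

open scoped FourierTransform RealInnerProductSpace

/-- The character `exp(2πir)`. -/
def planeWave (r : ℝ) : ℂ := Complex.exp (↑(2 * Real.pi * r) * Complex.I)

theorem fourierChar_coe (r : ℝ) : ((𝐞 r : Circle) : ℂ) = planeWave r := Real.fourierChar_apply r

@[simp] theorem norm_planeWave (r : ℝ) : ‖planeWave r‖ = 1 := Complex.norm_exp_ofReal_mul_I _

theorem measurable_planeWave : Measurable planeWave := by
  unfold planeWave
  fun_prop

theorem conj_planeWave (r : ℝ) : conj (planeWave r) = planeWave (-r) := by
  rw [planeWave, planeWave, ← Complex.exp_conj, map_mul, Complex.conj_ofReal, Complex.conj_I]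
  push_cast
  ring_nf

theorem planeWave_add (r s : ℝ) : planeWave (r + s) = planeWave r * planeWave s := by
  rw [planeWave, planeWave, planeWave, ← Complex.exp_add]
  push_cast
  ring_nf

variable {V : Type*} [NormedAddCommGroup V] [InnerProductSpace ℝ V]
  {M : Type*} [MeasurableSpace M]

/-- The oscillatory transform of `U` with respect to the phase function `φ`. -/
def phaseTransform (μ : Measure M) (φ : M → V) (U : M → ℂ) (ξ : V) : ℂ :=
  ∫ x, planeWave (-⟪ξ, φ x⟫) * U x ∂μ

theorem norm_phaseTransform_le (μ : Measure M) (φ : M → V) (U : M → ℂ) (ξ : V) :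
    ‖phaseTransform μ φ U ξ‖ ≤ ∫ x, ‖U x‖ ∂μ := by
  refine (norm_integral_le_integral_norm _).trans (le_of_eq ?_)
  simp

variable [FiniteDimensional ℝ V] [MeasurableSpace V] [BorelSpace V]

/-- A smooth compactly supported function is Schwartz, hence so is its Fourier transform; this gives
the moments, and inversion gives the formula. `WithLp 2` supplies the inner product on the product
space. -/
theorem exists_fourier_representation {Φ : V × V → ℂ} (hΦ : ContDiff ℝ ∞ Φ)
    (hc : HasCompactSupport Φ) :
    ∃ c : WithLp 2 (V × V) → ℂ, Continuous c ∧
      (∀ n : ℕ, Integrable (fun η => ‖η‖ ^ n * ‖c η‖)) ∧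
      ∀ z w : V, Φ (z, w) = ∫ η, planeWave (⟪η.fst, z⟫ + ⟪η.snd, w⟫) * c η := by
  let L := WithLp.prodContinuousLinearEquiv 2 ℝ V V
  have h1 : ContDiff ℝ ∞ (Φ ∘ L) := hΦ.comp L.contDiff
  have h2 : HasCompactSupport (Φ ∘ L) := hc.comp_homeomorph L.toHomeomorph
  let f := h2.toSchwartzMap h1
  let g : SchwartzMap (WithLp 2 (V × V)) ℂ := 𝓕 f
  refine ⟨g, g.continuous, fun n => g.integrable_pow_mul volume n, fun z w => ?_⟩
  have h3 : (𝓕⁻ g : SchwartzMap (WithLp 2 (V × V)) ℂ) (WithLp.toLp 2 (z, w)) = f (WithLp.toLp 2 (z, w)) := by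
    rw [FourierTransform.fourierInv_fourier_eq]
  have h4 : f (WithLp.toLp 2 (z, w)) = Φ (z, w) := rfl
  rw [← h4, ← h3, SchwartzMap.fourierInv_coe, Real.fourierInv_eq]
  refine integral_congr_ae (Filter.Eventually.of_forall fun η => ?_)
  simp [Circle.smul_def, fourierChar_coe, WithLp.prod_inner_apply]

/-- Each differentiation under the integral costs one power of `‖ξ‖`, so finite moments of all
orders give smoothness. -/
theorem contDiff_integral_fourierChar (ν : Measure V)
    (hν : ∀ n : ℕ, ∫⁻ ξ, ‖ξ‖ₑ ^ n ∂ν ≠ ⊤) :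
    ContDiff ℝ ∞ fun z : V => ∫ ξ, planeWave ⟪ξ, z⟫ ∂ν := by
  have := VectorFourier.contDiff_fourierIntegral (innerSL ℝ) (μ := ν) (f := fun _ : V => (1 : ℂ))
    (N := ⊤) (fun n _ => by
      simp only [norm_one, mul_one]
      refine ⟨by fun_prop, ?_⟩
      simpa [HasFiniteIntegral, enorm_pow] using (hν n).lt_top)
  have h2 : (fun z : V => ∫ ξ, planeWave ⟪ξ, z⟫ ∂ν) = (fun z => VectorFourier.fourierIntegral 𝐞 ν
      (innerSL ℝ).toLinearMap₁₂ (fun _ : V => (1 : ℂ)) z) ∘ fun z => -z := by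
    ext z
    simp [VectorFourier.fourierIntegral, Circle.smul_def, fourierChar_coe]
  rw [h2]
  exact this.comp contDiff_neg

theorem stronglyMeasurable_phaseTransform (μ : Measure M) [SFinite μ] {φ : M → V}
    (hφ : Measurable φ) {U : M → ℂ} (hU : AEStronglyMeasurable U μ) :
    StronglyMeasurable (phaseTransform μ φ U) := by
  have h0 : phaseTransform μ φ U = phaseTransform μ φ (hU.mk U) := by
    ext ξ
    refine integral_congr_ae ?_
    filter_upwards [hU.ae_eq_mk] with x hx
    rw [hx]
  rw [h0]
  refine StronglyMeasurable.integral_prod_right (f := fun ξ x => planeWave (-⟪ξ, φ x⟫) * hU.mk U x) ?_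
  have h1 : Measurable fun p : V × M => planeWave (-⟪p.1, φ p.2⟫) :=
    measurable_planeWave.comp (by fun_prop)
  exact h1.stronglyMeasurable.mul (hU.stronglyMeasurable_mk.comp_measurable measurable_snd)

/-- Fubini for a superposition of plane waves `exp(2πi(⟪P η, φ x⟫ - ⟪Q η, ψ y⟫))`. -/
theorem integral_prod_superposition {W : Type*} [MeasurableSpace W] (lam : Measure W) [SFinite lam]
    (μ : Measure M) [SFinite μ] {φ ψ : M → V} (hφ : Measurable φ) (hψ : Measurable ψ)
    {P Q : W → V} (hP : Measurable P) (hQ : Measurable Q) {c : W → ℂ} (hc : Integrable c lam)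
    {U₁ U₂ : M → ℂ} (h₁ : Integrable U₁ μ) (h₂ : Integrable U₂ μ) :
    Integrable (fun p : M × M => conj (U₁ p.1) * U₂ p.2 *
        ∫ η, planeWave (⟪P η, φ p.1⟫ - ⟪Q η, ψ p.2⟫) * c η ∂lam) (μ.prod μ) ∧
    ∫ p : M × M, conj (U₁ p.1) * U₂ p.2 *
        ∫ η, planeWave (⟪P η, φ p.1⟫ - ⟪Q η, ψ p.2⟫) * c η ∂lam ∂μ.prod μ =
      ∫ η, conj (phaseTransform μ φ U₁ (P η)) * phaseTransform μ ψ U₂ (Q η) * c η ∂lam := by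
  have h₁' : Integrable (fun x => conj (U₁ x)) μ := by
    simpa using (Complex.conjLIE.toContinuousLinearEquiv.toContinuousLinearMap).integrable_comp h₁
  have hint : Integrable (fun z : (M × M) × W => planeWave (⟪P z.2, φ z.1.1⟫ - ⟪Q z.2, ψ z.1.2⟫) *
      (conj (U₁ z.1.1) * U₂ z.1.2 * c z.2)) ((μ.prod μ).prod lam) := by
    have h3 := (h₁'.mul_prod h₂).mul_prod hc
    refine h3.mono (AEStronglyMeasurable.mul ?_ h3.1) (Filter.Eventually.of_forall fun z => ?_)
    · exact (measurable_planeWave.comp (by fun_prop)).aestronglyMeasurable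
    · simp
  have hpt : ∀ p : M × M, conj (U₁ p.1) * U₂ p.2 *
      ∫ η, planeWave (⟪P η, φ p.1⟫ - ⟪Q η, ψ p.2⟫) * c η ∂lam =
      ∫ η, planeWave (⟪P η, φ p.1⟫ - ⟪Q η, ψ p.2⟫) * (conj (U₁ p.1) * U₂ p.2 * c η) ∂lam := by
    intro p
    rw [← integral_const_mul]
    refine integral_congr_ae (Filter.Eventually.of_forall fun η => ?_)
    simp only
    ring
  simp only [hpt]
  refine ⟨hint.integral_prod_left, ?_⟩
  rw [integral_integral_swap hint]
  refine integral_congr_ae (Filter.Eventually.of_forall fun η => ?_)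
  simp only [phaseTransform]
  rw [← integral_conj, ← integral_prod_mul, ← integral_mul_const]
  refine integral_congr_ae (Filter.Eventually.of_forall fun p => ?_)
  simp only [map_mul, conj_planeWave, neg_neg, sub_eq_add_neg, planeWave_add]
  ring

/-- The analytic core: on the Fourier side the `Φ a b` form a matrix of densities, dominated by a
diagonal of measures whose Fourier integrals are the `G a`. The choice of `G` precedes `U` and `s`,
so one family serves all test sections. -/
theorem exists_dominating_functions {A : Type*} [Countable A] {Φ : A → A → V × V → ℂ}
    (hΦ : ∀ a b, ContDiff ℝ ∞ (Φ a b)) (hc : ∀ a b, HasCompactSupport (Φ a b))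
    (μ : Measure M) [SFinite μ] (φ : A → M → V) (hφ : ∀ a, Measurable (φ a)) :
    ∃ G : A → V → ℂ, (∀ a, ContDiff ℝ ∞ (G a)) ∧
      ∀ U : A → M → ℂ, (∀ a, Integrable (U a) μ) → ∀ s : Finset A,
        (∀ a, Integrable (fun p : M × M =>
          conj (U a p.1) * U a p.2 * G a (φ a p.1 - φ a p.2)) (μ.prod μ)) ∧
        (∀ a b, Integrable (fun p : M × M =>
          conj (U a p.1) * U b p.2 * Φ a b (φ a p.1, φ b p.2)) (μ.prod μ)) ∧
        ∃ r : ℝ,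
          ∑ a ∈ s, ∫ p : M × M, conj (U a p.1) * U a p.2 * G a (φ a p.1 - φ a p.2) ∂μ.prod μ = r ∧
          ‖∑ a ∈ s, ∑ b ∈ s, ∫ p : M × M,
            conj (U a p.1) * U b p.2 * Φ a b (φ a p.1, φ b p.2) ∂μ.prod μ‖ ≤ r := by
  choose c hcc hcn hcΦ using fun a b => exists_fourier_representation (hΦ a b) (hc a b)
  have hci : ∀ a b, Integrable (c a b) := fun a b => by
    have := hcn a b 0
    simp only [pow_zero, one_mul] at this
    exact (integrable_norm_iff (hcc a b).aestronglyMeasurable).1 this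
  set m : A → A → Measure (WithLp 2 (V × V)) := fun a b =>
    volume.withDensity fun η => ‖c a b η‖ₑ with hm
  have hce : ∀ a b, Measurable fun η => ‖c a b η‖ₑ := fun a b =>
    (hcc a b).enorm.measurable
  have hlm : ∀ a b (f : WithLp 2 (V × V) → ENNReal), Measurable f →
      ∫⁻ η, f η ∂m a b = ∫⁻ η, ‖c a b η‖ₑ * f η := fun a b f hf => by
    simp only [hm]
    rw [lintegral_withDensity_eq_lintegral_mul _ (hce a b) hf]
    rfl
  -- The second frequency enters with a minus sign below: the form is conjugate-linear in the first
  -- factor only, so the phase must be a difference.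
  have hP : Measurable fun η : WithLp 2 (V × V) => η.fst :=
    (WithLp.continuous_fst _ _ _).measurable
  have hQ : Measurable fun η : WithLp 2 (V × V) => -η.snd :=
    (WithLp.continuous_snd _ _ _).measurable.neg
  have hmom : ∀ a b (n : ℕ) (p : WithLp 2 (V × V) → V), Measurable p → (∀ η, ‖p η‖ ≤ ‖η‖) →
      ∫⁻ η, ‖p η‖ₑ ^ n ∂m a b ≠ ⊤ := by
    intro a b n p hp hle
    rw [hlm a b _ (by fun_prop)]
    have := (hcn a b n).2
    simp only [HasFiniteIntegral, enorm_mul, enorm_pow, enorm_norm] at this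
    refine ne_top_of_le_ne_top this.ne (lintegral_mono fun η => ?_)
    rw [mul_comm]
    have h1 : ‖p η‖ₑ ≤ ‖η‖ₑ := enorm_le_iff_norm_le.2 (hle η)
    gcongr
  obtain ⟨ν, hν, hdom⟩ := exists_dominating_measures m (fun η => η.fst) (fun η => -η.snd) hP hQ
    (fun a b n => hmom a b n _ hP fun η => WithLp.norm_fst_le _ η)
    (fun a b n => hmom a b n _ hQ fun η => by rw [norm_neg]; exact WithLp.norm_snd_le _ η)
  have hfin : ∀ a, IsFiniteMeasure (ν a) := fun a => ⟨by simpa using (hν a 0).lt_top⟩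
  refine ⟨fun a z => ∫ ξ, planeWave ⟪ξ, z⟫ ∂ν a, fun a => contDiff_integral_fourierChar (ν a) (hν a),
    fun U hU s => ?_⟩
  -- Coefficient 1 and equal frequencies in both slots: the general superposition formula then
  -- yields the integral of `|Û_a|²`.
  have hG : ∀ a, (fun p : M × M => conj (U a p.1) * U a p.2 *
      ∫ ξ, planeWave ⟪ξ, φ a p.1 - φ a p.2⟫ ∂ν a) = fun p : M × M => conj (U a p.1) * U a p.2 *
      ∫ ξ, planeWave (⟪ξ, φ a p.1⟫ - ⟪ξ, φ a p.2⟫) * 1 ∂ν a := fun a => by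
    simp only [inner_sub_right, mul_one]
  have hK : ∀ a b, (fun p : M × M => conj (U a p.1) * U b p.2 * Φ a b (φ a p.1, φ b p.2)) =
      fun p : M × M => conj (U a p.1) * U b p.2 *
      ∫ η : WithLp 2 (V × V), planeWave (⟪η.fst, φ a p.1⟫ - ⟪-η.snd, φ b p.2⟫) * c a b η :=
    fun a b => by simp only [hcΦ, inner_neg_left, sub_neg_eq_add]
  have hGI := fun a => integral_prod_superposition (ν a) μ (hφ a) (hφ a) measurable_id'
    measurable_id' (integrable_const (1 : ℂ)) (hU a) (hU a)
  have hKI := fun a b => integral_prod_superposition volume μ (hφ a) (hφ b) hP hQ (hci a b)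
    (hU a) (hU b)
  have hmeas : ∀ a, StronglyMeasurable (phaseTransform μ (φ a) (U a)) := fun a =>
    stronglyMeasurable_phaseTransform μ (hφ a) (hU a).1
  have hsq : ∀ a, Integrable (fun ξ => ‖phaseTransform μ (φ a) (U a) ξ‖ ^ 2) (ν a) := fun a => by
    refine Integrable.mono' (integrable_const ((∫ x, ‖U a x‖ ∂μ) ^ 2))
      ((hmeas a).norm.pow 2).aestronglyMeasurable (Filter.Eventually.of_forall fun ξ => ?_)
    rw [norm_pow, norm_norm]
    gcongr
    exact norm_phaseTransform_le _ _ _ _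
  refine ⟨fun a => by rw [hG]; exact (hGI a).1, fun a b => by rw [hK]; exact (hKI a b).1,
    ∑ a ∈ s, ∫ ξ, ‖phaseTransform μ (φ a) (U a) ξ‖ ^ 2 ∂ν a, ?_, ?_⟩
  · rw [Complex.ofReal_sum]
    refine Finset.sum_congr rfl fun a _ => ?_
    rw [hG, (hGI a).2, ← integral_complex_ofReal]
    refine integral_congr_ae (Filter.Eventually.of_forall fun ξ => ?_)
    simp [Complex.conj_mul']
  · have h1 : ‖∑ a ∈ s, ∑ b ∈ s, ∫ p : M × M,
        conj (U a p.1) * U b p.2 * Φ a b (φ a p.1, φ b p.2) ∂μ.prod μ‖ₑ ≤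
        ∑ a ∈ s, ∑ b ∈ s, ∫⁻ η, ‖phaseTransform μ (φ a) (U a) η.fst‖ₑ *
          ‖phaseTransform μ (φ b) (U b) (-η.snd)‖ₑ ∂m a b := by
      refine (enorm_sum_le _ _).trans (Finset.sum_le_sum fun a _ =>
        (enorm_sum_le _ _).trans (Finset.sum_le_sum fun b _ => ?_))
      rw [hK, (hKI a b).2]
      refine (enorm_integral_le_lintegral_enorm _).trans (le_of_eq ?_)
      have m1 : Measurable fun η : WithLp 2 (V × V) => ‖phaseTransform μ (φ a) (U a) η.fst‖ₑ :=
        (hmeas a).enorm.comp hP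
      have m2 : Measurable fun η : WithLp 2 (V × V) => ‖phaseTransform μ (φ b) (U b) (-η.snd)‖ₑ :=
        (hmeas b).enorm.comp hQ
      rw [hlm a b (fun η => _ * _) (m1.mul m2)]
      refine lintegral_congr fun η => ?_
      simp only [enorm_mul, RCLike.enorm_conj]
      ring
    have h2 := h1.trans (hdom s (fun a ξ => ‖phaseTransform μ (φ a) (U a) ξ‖ₑ)
      fun a => (hmeas a).enorm)
    have h3 : ∑ a ∈ s, ∫⁻ ξ, ‖phaseTransform μ (φ a) (U a) ξ‖ₑ ^ 2 ∂ν a =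
        ENNReal.ofReal (∑ a ∈ s, ∫ ξ, ‖phaseTransform μ (φ a) (U a) ξ‖ ^ 2 ∂ν a) := by
      rw [ENNReal.ofReal_sum_of_nonneg fun a _ => integral_nonneg fun _ => by positivity]
      refine Finset.sum_congr rfl fun a _ => ?_
      rw [ofReal_integral_eq_lintegral_ofReal (hsq a)
        (Filter.Eventually.of_forall fun _ => by positivity)]
      refine lintegral_congr fun ξ => ?_
      rw [ENNReal.ofReal_pow (norm_nonneg _), ofReal_norm]
    rw [h3, ← ofReal_norm] at h2
    exact (ENNReal.ofReal_le_ofReal_iff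
      (Finset.sum_nonneg fun a _ => integral_nonneg fun _ => by positivity)).1 h2

end FourierRepresentation

/-! ### Smoothness of complex-valued and vector-valued expressions -/

section SmoothCalculus

variable {EN HN N : Type*} [NormedAddCommGroup EN] [NormedSpace ℝ EN] [TopologicalSpace HN]
  {I : ModelWithCorners ℝ EN HN} [TopologicalSpace N] [ChartedSpace HN N]
  {s : Set N} {x : N}

theorem ContMDiffWithinAt.complex_mul {f g : N → ℂ} (hf : ContMDiffWithinAt I 𝓘(ℝ, ℂ) ∞ f s x)
    (hg : ContMDiffWithinAt I 𝓘(ℝ, ℂ) ∞ g s x) :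
    ContMDiffWithinAt I 𝓘(ℝ, ℂ) ∞ (fun y => f y * g y) s x := by
  have h : ContDiff ℝ ∞ fun p : ℂ × ℂ => p.1 * p.2 := contDiff_mul
  exact h.contMDiff.contMDiffAt.comp_contMDiffWithinAt x (hf.prodMk_space hg)

theorem ContMDiffWithinAt.complex_conj {f : N → ℂ} (hf : ContMDiffWithinAt I 𝓘(ℝ, ℂ) ∞ f s x) :
    ContMDiffWithinAt I 𝓘(ℝ, ℂ) ∞ (fun y => conj (f y)) s x :=
  Complex.conjCLE.contDiff.contMDiff.contMDiffAt.comp_contMDiffWithinAt x hf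

theorem ContMDiffWithinAt.complex_sum {ι V : Type*} [NormedAddCommGroup V] [NormedSpace ℝ V]
    {f : ι → N → V} (t : Finset ι)
    (hf : ∀ i ∈ t, ContMDiffWithinAt I 𝓘(ℝ, V) ∞ (f i) s x) :
    ContMDiffWithinAt I 𝓘(ℝ, V) ∞ (fun y => ∑ i ∈ t, f i y) s x :=
  contMDiffWithinAt_finsetSum hf

variable {F : Type*} [NormedAddCommGroup F] [NormedSpace ℂ F]

theorem ContMDiffWithinAt.complex_smul {f : N → ℂ} {g : N → F}
    (hf : ContMDiffWithinAt I 𝓘(ℝ, ℂ) ∞ f s x) (hg : ContMDiffWithinAt I 𝓘(ℝ, F) ∞ g s x) :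
    ContMDiffWithinAt I 𝓘(ℝ, F) ∞ (fun y => f y • g y) s x := by
  have h : ContDiff ℝ ∞ fun p : ℂ × F => p.1 • p.2 := contDiff_smul
  exact h.contMDiff.contMDiffAt.comp_contMDiffWithinAt x (hf.prodMk_space hg)

theorem ContMDiffWithinAt.complex_linear [FiniteDimensional ℂ F] {V : Type*}
    [NormedAddCommGroup V] [NormedSpace ℂ V] (L : F →ₗ[ℂ] V) {g : N → F}
    (hg : ContMDiffWithinAt I 𝓘(ℝ, F) ∞ g s x) :
    ContMDiffWithinAt I 𝓘(ℝ, V) ∞ (fun y => L (g y)) s x :=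
  ((L.toContinuousLinearMap).restrictScalars ℝ).contDiff.contMDiff.contMDiffAt.comp_contMDiffWithinAt
    x hg

/-- Cramer's rule: determinant and adjugate are polynomial in the entries. -/
theorem ContMDiffWithinAt.matrix_inv_apply {n : Type*} [Fintype n] [DecidableEq n]
    {A : N → Matrix n n ℂ} (hA : ∀ i j, ContMDiffWithinAt I 𝓘(ℝ, ℂ) ∞ (fun y => A y i j) s x)
    (hx : (A x).det ≠ 0) (i j : n) :
    ContMDiffWithinAt I 𝓘(ℝ, ℂ) ∞ (fun y => (A y)⁻¹ i j) s x := by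
  have hdet : ContDiff ℝ ∞ fun B : n → n → ℂ => (Matrix.of B).det := by
    simp only [Matrix.det_apply, Matrix.of_apply]
    fun_prop
  have hadj : ContDiff ℝ ∞ fun B : n → n → ℂ => (Matrix.of B).adjugate i j := by
    simp only [Matrix.adjugate_apply]
    refine hdet.comp (g := fun B : n → n → ℂ => (Matrix.of B).det)
      (f := fun B : n → n → ℂ => Function.update B j (Pi.single i 1)) ?_
    refine contDiff_pi.2 fun k => ?_
    by_cases hk : k = j
    · subst hk; simpa using contDiff_const
    · simpa [Function.update_of_ne hk] using contDiff_apply ℝ (n → ℂ) k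
  have hA' : ContMDiffWithinAt I 𝓘(ℝ, n → n → ℂ) ∞ (fun y i j => A y i j) s x :=
    contMDiffWithinAt_pi_space.2 fun i => contMDiffWithinAt_pi_space.2 fun j => hA i j
  have hinv : ContDiffAt ℝ ∞ (fun B : n → n → ℂ =>
      (Matrix.of B).det⁻¹ * (Matrix.of B).adjugate i j) (A x) :=
    (hdet.contDiffAt.inv hx).mul hadj.contDiffAt
  have := (hinv.contMDiffAt).comp_contMDiffWithinAt x hA'
  refine this.congr (fun y _ => ?_) ?_ <;>
  · simp [Matrix.inv_def, Function.comp, Ring.inverse_eq_inv']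
    rfl

end SmoothCalculus

/-! ### Local frames and their duals for an indefinite metric -/

section Sections

variable {d : ℕ} {M : Type*} [TopologicalSpace M] [ChartedSpace (EuclideanSpace ℝ (Fin d)) M]
  {F : Type*} [NormedAddCommGroup F] [NormedSpace ℂ F]
  {E : M → Type*} [∀ x, AddCommGroup (E x)] [∀ x, Module ℂ (E x)]
  [TopologicalSpace (TotalSpace F E)] [∀ x, TopologicalSpace (E x)]
  [FiberBundle F E]

/-- Smoothness of a section on a set. -/
abbrev IsSmoothSectionOn (d : ℕ) {M : Type*} [TopologicalSpace M]
    [ChartedSpace (EuclideanSpace ℝ (Fin d)) M] (F : Type*) [NormedAddCommGroup F]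
    [NormedSpace ℂ F] {E : M → Type*} [∀ x, AddCommGroup (E x)] [∀ x, Module ℂ (E x)]
    [TopologicalSpace (TotalSpace F E)] [∀ x, TopologicalSpace (E x)] [FiberBundle F E]
    (u : ∀ x, E x) (s : Set M) : Prop :=
  ContMDiffOn (𝓡 d) ((𝓡 d).prod 𝓘(ℝ, F)) ∞ (fun x => TotalSpace.mk' F x (u x)) s

/-- The frame of `E` near `x₀` that is constant in the preferred trivialization. -/
def trivFrame (F : Type*) [NormedAddCommGroup F] [NormedSpace ℂ F] {E : M → Type*}
    [∀ x, AddCommGroup (E x)] [∀ x, Module ℂ (E x)]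
    [TopologicalSpace (TotalSpace F E)] [∀ x, TopologicalSpace (E x)] [FiberBundle F E]
    [FiniteDimensional ℂ F] (x₀ : M) (α : Fin (Module.finrank ℂ F)) (x : M) : E x :=
  (trivializationAt F E x₀).symm x (Module.finBasis ℂ F α)

variable [VectorBundle ℂ F E]

theorem trivialization_symm_sum_smul {x₀ x : M}
    (hx : x ∈ (trivializationAt F E x₀).baseSet) {ι : Type*} (t : Finset ι) (c : ι → ℂ) (a : ι → F) :
    (trivializationAt F E x₀).symm x (∑ i ∈ t, c i • a i) =
      ∑ i ∈ t, c i • (trivializationAt F E x₀).symm x (a i) := by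
  simp only [← Trivialization.coe_symmₗ (R := ℂ) _ hx, map_sum, map_smul]

theorem trivialization_apply_sum_smul {x₀ x : M} (hx : x ∈ (trivializationAt F E x₀).baseSet)
    {ι : Type*} (t : Finset ι) (c : ι → ℂ) (v : ι → E x) :
    (trivializationAt F E x₀ ⟨x, ∑ i ∈ t, c i • v i⟩).2 =
      ∑ i ∈ t, c i • (trivializationAt F E x₀ ⟨x, v i⟩).2 := by
  let L : E x →ₗ[ℂ] F := (Trivialization.linear ℂ (trivializationAt F E x₀) hx).mk' _
  change L (∑ i ∈ t, c i • v i) = ∑ i ∈ t, c i • L (v i)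
  simp only [map_sum, map_smul]

theorem isSmoothSectionOn_sum_smul [ContMDiffVectorBundle ∞ F E (𝓡 d)] {ι : Type*}
    (t : Finset ι) {c : ι → M → ℂ}
    {e : ι → ∀ x, E x} {s : Set M}
    (hc : ∀ i ∈ t, ContMDiffOn (𝓡 d) 𝓘(ℝ, ℂ) ∞ (c i) s)
    (he : ∀ i ∈ t, IsSmoothSectionOn d F (e i) s) :
    IsSmoothSectionOn d F (fun x => ∑ i ∈ t, c i x • e i x) s := by
  intro x hx
  have hb := FiberBundle.mem_baseSet_trivializationAt' (F := F) (E := E) x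
  rw [Trivialization.contMDiffWithinAt_section s hb]
  have h1 : ∀ y ∈ (trivializationAt F E x).baseSet,
      (trivializationAt F E x ⟨y, ∑ i ∈ t, c i y • e i y⟩).2 =
      ∑ i ∈ t, c i y • (trivializationAt F E x ⟨y, e i y⟩).2 := by
    intro y hy
    exact trivialization_apply_sum_smul hy t _ _
  have h2 : ContMDiffWithinAt (𝓡 d) 𝓘(ℝ, F) ∞
      (fun y => ∑ i ∈ t, c i y • (trivializationAt F E x ⟨y, e i y⟩).2) s x :=
    ContMDiffWithinAt.complex_sum t fun i hi => (hc i hi x hx).complex_smul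
      ((Trivialization.contMDiffWithinAt_section s hb).1 (he i hi x hx))
  refine h2.congr_of_eventuallyEq ?_ (h1 x hb)
  filter_upwards [mem_nhdsWithin_of_mem_nhds ((trivializationAt F E x).open_baseSet.mem_nhds hb)]
    with y hy using h1 y hy

variable [FiniteDimensional ℂ F]

theorem trivialization_symm_eq_sum {x₀ x : M} (hx : x ∈ (trivializationAt F E x₀).baseSet) (a : F) :
    (trivializationAt F E x₀).symm x a =
      ∑ α, (Module.finBasis ℂ F).repr a α • trivFrame (E := E) F x₀ α x := by
  conv_lhs => rw [← (Module.finBasis ℂ F).sum_repr a]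
  rw [trivialization_symm_sum_smul hx]
  rfl

theorem eq_sum_repr_smul_trivFrame {x₀ x : M} (hx : x ∈ (trivializationAt F E x₀).baseSet)
    (v : E x) :
    v = ∑ α, (Module.finBasis ℂ F).repr (trivializationAt F E x₀ ⟨x, v⟩).2 α •
      trivFrame (E := E) F x₀ α x := by
  rw [← trivialization_symm_eq_sum hx, Trivialization.symm_apply_apply_mk _ hx]

theorem linearIndependent_trivFrame {x₀ x : M} (hx : x ∈ (trivializationAt F E x₀).baseSet)
    {c : Fin (Module.finrank ℂ F) → ℂ} (hc : ∑ α, c α • trivFrame (E := E) F x₀ α x = 0) :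
    c = 0 := by
  have h1 : (trivializationAt F E x₀).symm x (∑ α, c α • Module.finBasis ℂ F α) = 0 := by
    rw [← hc]
    rw [trivialization_symm_sum_smul hx]
    rfl
  have h2 : ∑ α, c α • Module.finBasis ℂ F α = 0 := by
    have := congrArg (fun v => (trivializationAt F E x₀ ⟨x, v⟩).2) h1
    simp only [Trivialization.apply_mk_symm _ hx] at this
    rw [this]
    have := (Trivialization.linear ℂ (trivializationAt F E x₀) hx).map_zero
    exact this
  funext α
  exact Fintype.linearIndependent_iff.1 (Module.finBasis ℂ F).linearIndependent c h2 α

/-- The Gram matrix of the local frame. -/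
def HermitianBundleMetric.gram (h : HermitianBundleMetric d F E) (x₀ x : M) :
    Matrix (Fin (Module.finrank ℂ F)) (Fin (Module.finrank ℂ F)) ℂ :=
  fun α β => h.form x (trivFrame F x₀ α x) (trivFrame F x₀ β x)

/-- A null vector of the Gram matrix gives a combination of frame vectors orthogonal to the whole
fibre, which vanishes by nondegeneracy. Positivity is not needed. -/
theorem HermitianBundleMetric.det_gram_ne_zero (h : HermitianBundleMetric d F E) {x₀ x : M}
    (hx : x ∈ (trivializationAt F E x₀).baseSet) : (h.gram x₀ x).det ≠ 0 := by
  intro h0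
  obtain ⟨c, hc, hc0⟩ := Matrix.exists_mulVec_eq_zero_iff.2 h0
  refine hc (linearIndependent_trivFrame hx ?_)
  have h1 : ∀ α, h.form x (trivFrame F x₀ α x) (∑ β, c β • trivFrame F x₀ β x) = 0 := by
    intro α
    have := congrFun hc0 α
    simp only [Matrix.mulVec, dotProduct, HermitianBundleMetric.gram, Pi.zero_apply] at this
    simpa [mul_comm] using this
  refine h.nondegenerate x _ fun w => ?_
  generalize ∑ β, c β • trivFrame (E := E) F x₀ β x = v at h1 ⊢
  rw [← h.hermitian, map_eq_zero, eq_sum_repr_smul_trivFrame hx w, map_sum, LinearMap.sum_apply]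
  refine Finset.sum_eq_zero fun α _ => ?_
  rw [LinearMap.map_smulₛₗ, LinearMap.smul_apply, h1, smul_zero]

/-- The frame dual to the local frame with respect to the fibre metric. -/
def HermitianBundleMetric.dualFrame (h : HermitianBundleMetric d F E) (x₀ : M)
    (α : Fin (Module.finrank ℂ F)) (x : M) : E x :=
  ∑ β, (h.gram x₀ x)⁻¹ β α • trivFrame F x₀ β x

theorem HermitianBundleMetric.form_trivFrame_dualFrame (h : HermitianBundleMetric d F E) {x₀ x : M}
    (hx : x ∈ (trivializationAt F E x₀).baseSet) (α β : Fin (Module.finrank ℂ F)) :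
    h.form x (trivFrame F x₀ α x) (h.dualFrame x₀ β x) = if α = β then 1 else 0 := by
  have := congrFun (congrFun (Matrix.mul_nonsing_inv (h.gram x₀ x)
    (h.det_gram_ne_zero hx).isUnit) α) β
  rw [Matrix.one_apply, Matrix.mul_apply] at this
  rw [← this]
  simp [HermitianBundleMetric.dualFrame, HermitianBundleMetric.gram, mul_comm]

theorem HermitianBundleMetric.eq_sum_dualFrame (h : HermitianBundleMetric d F E) {x₀ x : M}
    (hx : x ∈ (trivializationAt F E x₀).baseSet) (v : E x) :
    v = ∑ α, h.form x (trivFrame F x₀ α x) v • h.dualFrame x₀ α x := by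
  rw [← sub_eq_zero]
  refine h.nondegenerate x _ fun w => ?_
  rw [← h.hermitian, map_eq_zero, eq_sum_repr_smul_trivFrame hx w]
  simp only [map_sum, LinearMap.map_smulₛₗ, LinearMap.sum_apply, LinearMap.smul_apply, map_sub,
    h.form_trivFrame_dualFrame hx]
  simp [mul_comm]

/-- Turns coordinates in the trivialization into pairings, so that smoothness of kernels can be
tested on scalar functions. -/
theorem HermitianBundleMetric.repr_eq_form_dualFrame (h : HermitianBundleMetric d F E) {x₀ x : M}
    (hx : x ∈ (trivializationAt F E x₀).baseSet) (v : E x) (α : Fin (Module.finrank ℂ F)) :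
    (Module.finBasis ℂ F).repr (trivializationAt F E x₀ ⟨x, v⟩).2 α =
      h.form x (h.dualFrame x₀ α x) v := by
  conv_rhs => rw [eq_sum_repr_smul_trivFrame hx v]
  simp only [map_sum, map_smul]
  have : ∀ β, h.form x (h.dualFrame x₀ α x) (trivFrame F x₀ β x) = if β = α then 1 else 0 := by
    intro β
    rw [← h.hermitian, h.form_trivFrame_dualFrame hx]
    split_ifs <;> simp
  simp [this]

variable [ContMDiffVectorBundle ∞ F E (𝓡 d)]

theorem isSmoothSectionOn_trivFrame (x₀ : M) (α : Fin (Module.finrank ℂ F)) :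
    IsSmoothSectionOn d F (trivFrame (E := E) F x₀ α) (trivializationAt F E x₀).baseSet := by
  refine (Trivialization.contMDiffOn_section_baseSet_iff _).2 ?_
  refine (contMDiffOn_const (c := Module.finBasis ℂ F α)).congr fun x hx => ?_
  rw [trivFrame, Trivialization.apply_mk_symm _ hx]

theorem IsSmoothSectionOn.contMDiffWithinAt_repr {u : ∀ x, E x} {s : Set M} {x x₀ : M}
    (hu : IsSmoothSectionOn d F u s) (hx : x ∈ s) (hx₀ : x ∈ (trivializationAt F E x₀).baseSet)
    (α : Fin (Module.finrank ℂ F)) :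
    ContMDiffWithinAt (𝓡 d) 𝓘(ℝ, ℂ) ∞
      (fun y => (Module.finBasis ℂ F).repr (trivializationAt F E x₀ ⟨y, u y⟩).2 α) s x := by
  have h1 := (Trivialization.contMDiffWithinAt_section s hx₀).1 (hu x hx)
  exact h1.complex_linear ((Module.finBasis ℂ F).coord α)

theorem HermitianBundleMetric.contMDiffOn_form (h : HermitianBundleMetric d F E) {u w : ∀ x, E x}
    {s : Set M} (hu : IsSmoothSectionOn d F u s) (hw : IsSmoothSectionOn d F w s) :
    ContMDiffOn (𝓡 d) 𝓘(ℝ, ℂ) ∞ (fun x => h.form x (u x) (w x)) s := by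
  intro x hx
  have hb := FiberBundle.mem_baseSet_trivializationAt' (F := F) (E := E) x
  have h1 : ∀ y ∈ (trivializationAt F E x).baseSet, h.form y (u y) (w y) =
      ∑ α, ∑ β, conj ((Module.finBasis ℂ F).repr (trivializationAt F E x ⟨y, u y⟩).2 α) *
        ((Module.finBasis ℂ F).repr (trivializationAt F E x ⟨y, w y⟩).2 β *
        h.form y (trivFrame F x α y) (trivFrame F x β y)) := by
    intro y hy
    conv_lhs => rw [eq_sum_repr_smul_trivFrame hy (u y), eq_sum_repr_smul_trivFrame hy (w y)]
    simp only [map_sum, LinearMap.map_smulₛₗ, LinearMap.sum_apply, LinearMap.smul_apply,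
      smul_eq_mul, RingHom.id_apply, Finset.mul_sum]
    rw [Finset.sum_comm]
    refine Finset.sum_congr rfl fun α _ => Finset.sum_congr rfl fun β _ => ?_
    ring
  have h2 := ContMDiffWithinAt.complex_sum Finset.univ fun α _ =>
    ContMDiffWithinAt.complex_sum Finset.univ fun β _ =>
      (hu.contMDiffWithinAt_repr hx hb α).complex_conj.complex_mul
        ((hw.contMDiffWithinAt_repr hx hb β).complex_mul
          (((h.smooth x (Module.finBasis ℂ F α) (Module.finBasis ℂ F β)).contMDiffAt
            ((trivializationAt F E x).open_baseSet.mem_nhds hb)).contMDiffWithinAt (s := s)))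
  refine h2.congr_of_eventuallyEq ?_ (h1 x hb)
  filter_upwards [mem_nhdsWithin_of_mem_nhds ((trivializationAt F E x).open_baseSet.mem_nhds hb)]
    with y hy using h1 y hy

theorem HermitianBundleMetric.isSmoothSectionOn_dualFrame (h : HermitianBundleMetric d F E)
    (x₀ : M) (α : Fin (Module.finrank ℂ F)) :
    IsSmoothSectionOn d F (h.dualFrame x₀ α) (trivializationAt F E x₀).baseSet :=
  isSmoothSectionOn_sum_smul _ (fun _ _ x hx => ContMDiffWithinAt.matrix_inv_apply
    (fun _ _ => h.smooth x₀ _ _ x hx) (h.det_gram_ne_zero hx) _ _)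
    fun β _ => isSmoothSectionOn_trivFrame x₀ β

end Sections

/-! ### Kernels: conjugation and smoothness through scalar coefficients -/

section Kernels

variable {d : ℕ} {M : Type*} [TopologicalSpace M] [ChartedSpace (EuclideanSpace ℝ (Fin d)) M]
  {F : Type*} [NormedAddCommGroup F] [NormedSpace ℂ F]
  {E : M → Type*} [∀ x, AddCommGroup (E x)] [∀ x, Module ℂ (E x)]
  [TopologicalSpace (TotalSpace F E)] [∀ x, TopologicalSpace (E x)]
  [FiberBundle F E]

section Conjugation

variable {h : HermitianBundleMetric d F E} (c : ComplexConjugation h)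

theorem ComplexConjugation.isSmoothSectionOn {u : ∀ x, E x} {s : Set M}
    (hu : IsSmoothSectionOn d F u s) : IsSmoothSectionOn d F (fun x => c.toMap x (u x)) s :=
  c.smooth.comp_contMDiffOn hu

/-- The kernel `(x, y) ↦ c ∘ k(x, y) ∘ c`. -/
def ComplexConjugation.conjKernel (k : BundleKernel E) : BundleKernel E :=
  fun x y => (c.toMap x).comp ((k x y).comp (c.toMap y))

theorem ComplexConjugation.conjKernel_apply (k : BundleKernel E) (x y : M) (v : E y) :
    c.conjKernel k x y v = c.toMap x (k x y (c.toMap y v)) := rfl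

theorem ComplexConjugation.form_conjKernel (k : BundleKernel E) (x y : M) (v : E x) (w : E y) :
    h.form x v (c.conjKernel k x y w) = conj (h.form x (c.toMap x v) (k x y (c.toMap y w))) := by
  rw [h.hermitian, c.conjKernel_apply]
  conv_lhs => rw [← c.involutive x v]
  rw [c.compatible]

theorem ComplexConjugation.isRealKernel_add_conjKernel (k : BundleKernel E) :
    IsRealKernel c (k + c.conjKernel k) := by
  intro x y v
  simp only [Pi.add_apply, LinearMap.add_apply, map_add, c.conjKernel_apply, c.involutive]
  exact add_comm _ _

theorem ComplexConjugation.toMap_eq_zero {x : M} {v : E x} : c.toMap x v = 0 ↔ v = 0 := by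
  refine ⟨fun hv => ?_, fun hv => by rw [hv, map_zero]⟩
  rw [← c.involutive x v, hv, map_zero]

theorem ComplexConjugation.conjKernel_eq_zero {k : BundleKernel E} {x y : M} (hk : k x y = 0) :
    c.conjKernel k x y = 0 := by
  ext v
  simp [c.conjKernel_apply, hk]

/-- The form of the conjugated kernel at `u` is the complex conjugate of the form of `k` at the
conjugate section, which is real and nonnegative. -/
theorem ComplexConjugation.isNonnegKernel_conjKernel [MeasurableSpace M] {μ : Measure M}
    {k : BundleKernel E} (hk : IsNonnegKernel μ h k) : IsNonnegKernel μ h (c.conjKernel k) := by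
  intro u hu hc
  have hu' : ContMDiff (𝓡 d) ((𝓡 d).prod 𝓘(ℝ, F)) ∞
      (fun x => TotalSpace.mk' F x (c.toMap x (u x))) := c.smooth.comp hu
  have h1 := hk (fun x => c.toMap x (u x)) hu' (by simpa only [ne_eq, c.toMap_eq_zero] using hc)
  simp only [c.form_conjKernel, integral_conj]
  rwa [Complex.conj_eq_iff_im.2 (Complex.nonneg_iff.1 h1).2.symm]

end Conjugation

variable [VectorBundle ℂ F E] [FiniteDimensional ℂ F]

theorem isSmoothKernel_of_form (h : HermitianBundleMetric d F E) {k : BundleKernel E}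
    (hk : ∀ x₀ y₀ α β, ContMDiffOn ((𝓡 d).prod (𝓡 d)) 𝓘(ℝ, ℂ) ∞
      (fun p : M × M => h.form p.1 (h.dualFrame x₀ α p.1) (k p.1 p.2 (trivFrame F y₀ β p.2)))
      ((trivializationAt F E x₀).baseSet ×ˢ (trivializationAt F E y₀).baseSet)) :
    IsSmoothKernel d F k := by
  intro x₀ y₀ a
  have h1 : ∀ p ∈ (trivializationAt F E x₀).baseSet ×ˢ (trivializationAt F E y₀).baseSet,
      (trivializationAt F E x₀ ⟨p.1, k p.1 p.2 ((trivializationAt F E y₀).symm p.2 a)⟩).2 =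
      ∑ α, (∑ β, (Module.finBasis ℂ F).repr a β *
        h.form p.1 (h.dualFrame x₀ α p.1) (k p.1 p.2 (trivFrame F y₀ β p.2))) •
        Module.finBasis ℂ F α := by
    rintro p ⟨hp1, hp2⟩
    rw [← (Module.finBasis ℂ F).sum_repr
      (trivializationAt F E x₀ ⟨p.1, k p.1 p.2 ((trivializationAt F E y₀).symm p.2 a)⟩).2]
    refine Finset.sum_congr rfl fun α _ => ?_
    congr 1
    rw [h.repr_eq_form_dualFrame hp1, trivialization_symm_eq_sum hp2]
    simp only [map_sum, map_smul, smul_eq_mul]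
  refine ContMDiffOn.congr (fun p hp => ?_) h1
  exact ContMDiffWithinAt.complex_sum _ fun α _ => ContMDiffWithinAt.complex_smul
    (ContMDiffWithinAt.complex_sum _ fun β _ => contMDiffWithinAt_const.complex_mul
      (hk x₀ y₀ α β p hp)) contMDiffWithinAt_const

variable [ContMDiffVectorBundle ∞ F E (𝓡 d)]

/-- The converse direction to `isSmoothKernel_of_form`, for arbitrary smooth local sections: both
arguments of the form are expanded in the frames at the point in question. -/
theorem IsSmoothKernel.contMDiffOn_form (h : HermitianBundleMetric d F E) {k : BundleKernel E}
    (hk : IsSmoothKernel d F k) {v w : ∀ x, E x} {s t : Set M} (hs : IsOpen s) (ht : IsOpen t)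
    (hv : IsSmoothSectionOn d F v s) (hw : IsSmoothSectionOn d F w t) :
    ContMDiffOn ((𝓡 d).prod (𝓡 d)) 𝓘(ℝ, ℂ) ∞
      (fun p : M × M => h.form p.1 (v p.1) (k p.1 p.2 (w p.2))) (s ×ˢ t) := by
  rintro ⟨x, y⟩ ⟨hx, hy⟩
  have hbx := FiberBundle.mem_baseSet_trivializationAt' (F := F) (E := E) x
  have hby := FiberBundle.mem_baseSet_trivializationAt' (F := F) (E := E) y
  set bx := (trivializationAt F E x).baseSet with hbxd
  set cy := (trivializationAt F E y).baseSet with hbyd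
  have hox : IsOpen (s ∩ bx) := hs.inter (trivializationAt F E x).open_baseSet
  have hoy : IsOpen (t ∩ cy) := ht.inter (trivializationAt F E y).open_baseSet
  have h1 : ∀ p ∈ (s ∩ bx) ×ˢ (t ∩ cy), h.form p.1 (v p.1) (k p.1 p.2 (w p.2)) =
      ∑ β, (Module.finBasis ℂ F).repr (trivializationAt F E y ⟨p.2, w p.2⟩).2 β *
        ∑ γ, (Module.finBasis ℂ F).coord γ
          (trivializationAt F E x ⟨p.1, k p.1 p.2 (trivFrame F y β p.2)⟩).2 *
          h.form p.1 (v p.1) (trivFrame F x γ p.1) := by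
    rintro p ⟨hp1, hp2⟩
    conv_lhs => rw [eq_sum_repr_smul_trivFrame hp2.2 (w p.2)]
    simp only [map_sum, map_smul, smul_eq_mul]
    refine Finset.sum_congr rfl fun β _ => ?_
    congr 1
    conv_lhs => rw [eq_sum_repr_smul_trivFrame hp1.2 (k p.1 p.2 (trivFrame F y β p.2))]
    simp only [map_sum, map_smul, smul_eq_mul, Module.Basis.coord_apply]
  have h2 : ContMDiffOn ((𝓡 d).prod (𝓡 d)) 𝓘(ℝ, ℂ) ∞
      (fun p : M × M => h.form p.1 (v p.1) (k p.1 p.2 (w p.2))) ((s ∩ bx) ×ˢ (t ∩ cy)) := by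
    refine ContMDiffOn.congr (fun p hp => ?_) h1
    refine ContMDiffWithinAt.complex_sum _ fun β _ => ContMDiffWithinAt.complex_mul ?_
      (ContMDiffWithinAt.complex_sum _ fun γ _ => ContMDiffWithinAt.complex_mul ?_ ?_)
    · exact (hw.contMDiffWithinAt_repr hp.2.1 hp.2.2 β).comp p contMDiffWithinAt_snd
        fun q hq => hq.2.1
    · exact ContMDiffWithinAt.complex_linear _ ((hk x y (Module.finBasis ℂ F β) p
        ⟨hp.1.2, hp.2.2⟩).mono (Set.prod_mono Set.inter_subset_right Set.inter_subset_right))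
    · exact ((h.contMDiffOn_form (hv.mono Set.inter_subset_left)
        ((isSmoothSectionOn_trivFrame x γ).mono Set.inter_subset_right)) p.1 hp.1).comp p
        contMDiffWithinAt_fst fun q hq => hq.1
  exact (h2.contMDiffAt ((hox.prod hoy).mem_nhds ⟨⟨hx, hbx⟩, ⟨hy, hby⟩⟩)).contMDiffWithinAt

theorem IsSmoothKernel.add (h : HermitianBundleMetric d F E) {k l : BundleKernel E}
    (hk : IsSmoothKernel d F k) (hl : IsSmoothKernel d F l) : IsSmoothKernel d F (k + l) := by
  refine isSmoothKernel_of_form h fun x₀ y₀ α β => ?_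
  have := fun {m : BundleKernel E} (hm : IsSmoothKernel d F m) => hm.contMDiffOn_form h
    (trivializationAt F E x₀).open_baseSet (trivializationAt F E y₀).open_baseSet
    (h.isSmoothSectionOn_dualFrame x₀ α) (isSmoothSectionOn_trivFrame y₀ β)
  refine ((this hk).add (this hl)).congr fun p _ => ?_
  simp

theorem IsSmoothKernel.sub (h : HermitianBundleMetric d F E) {k l : BundleKernel E}
    (hk : IsSmoothKernel d F k) (hl : IsSmoothKernel d F l) : IsSmoothKernel d F (k - l) := by
  refine isSmoothKernel_of_form h fun x₀ y₀ α β => ?_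
  have := fun {m : BundleKernel E} (hm : IsSmoothKernel d F m) => hm.contMDiffOn_form h
    (trivializationAt F E x₀).open_baseSet (trivializationAt F E y₀).open_baseSet
    (h.isSmoothSectionOn_dualFrame x₀ α) (isSmoothSectionOn_trivFrame y₀ β)
  refine ((this hk).sub (this hl)).congr fun p _ => ?_
  simp

theorem ComplexConjugation.isSmoothKernel_conjKernel {h : HermitianBundleMetric d F E}
    (c : ComplexConjugation h) {k : BundleKernel E}
    (hk : IsSmoothKernel d F k) : IsSmoothKernel d F (c.conjKernel k) := by
  refine isSmoothKernel_of_form h fun x₀ y₀ α β p hp => ?_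
  simp only [c.form_conjKernel]
  exact (hk.contMDiffOn_form h
    (trivializationAt F E x₀).open_baseSet (trivializationAt F E y₀).open_baseSet
    (c.isSmoothSectionOn (h.isSmoothSectionOn_dualFrame x₀ α))
    (c.isSmoothSectionOn (isSmoothSectionOn_trivFrame y₀ β)) p hp).complex_conj

end Kernels

/-! ### Densities, partitions and charts on the base -/

section Base

variable {d : ℕ} {M : Type u} [TopologicalSpace M]
  [ChartedSpace (EuclideanSpace ℝ (Fin d)) M]

theorem IsSmoothPositiveDensity.isLocallyFiniteMeasure [T2Space M] [MeasurableSpace M] [BorelSpace M]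
    {μ : Measure M} (hμ : IsSmoothPositiveDensity d μ) : IsLocallyFiniteMeasure μ := by
  have : LocallyCompactSpace M := ChartedSpace.locallyCompactSpace (EuclideanSpace ℝ (Fin d)) M
  refine ⟨fun x => ?_⟩
  obtain ⟨ρ, hρ, -, hρμ⟩ := hμ _ (chart_mem_atlas (EuclideanSpace ℝ (Fin d)) x)
  obtain ⟨C, hC, hxC, hCs⟩ := exists_compact_subset
    (chartAt (EuclideanSpace ℝ (Fin d)) x).open_source (mem_chart_source _ x)
  refine ⟨C, mem_interior_iff_mem_nhds.1 hxC, ?_⟩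
  rw [hρμ C hCs hC.measurableSet]
  have himg : IsCompact (chartAt (EuclideanSpace ℝ (Fin d)) x '' C) :=
    hC.image_of_continuousOn ((chartAt _ x).continuousOn.mono hCs)
  refine Integrable.lintegral_lt_top ((hρ.continuousOn.mono ?_).integrableOn_compact himg)
  rintro _ ⟨y, hy, rfl⟩
  exact (chartAt _ x).map_source (hCs hy)

/-- With bumps `f i` and `S = ∑ (f i)²`, take `χ = f` and `θ = f / S`. Two cutoffs are wanted
because one multiplies a frame and the other its dual. Countability of the index set is what the
choice of weights requires. -/
theorem exists_normalized_bumpCovering [T2Space M] [SecondCountableTopology M] [IsManifold (𝓡 d) ∞ M]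
    {U : M → Set M} (hU : ∀ x, U x ∈ nhds x) :
    ∃ (ι : Type u) (_ : Countable ι) (c : ι → M) (χ θ : ι → M → ℝ),
      (∀ i, ContMDiff (𝓡 d) 𝓘(ℝ, ℝ) ∞ (χ i)) ∧ (∀ i, ContMDiff (𝓡 d) 𝓘(ℝ, ℝ) ∞ (θ i)) ∧
      (∀ i, IsCompact (tsupport (χ i))) ∧ (∀ i, tsupport (χ i) ⊆ U (c i)) ∧
      (∀ i, tsupport (θ i) ⊆ tsupport (χ i)) ∧
      (LocallyFinite fun i => tsupport (χ i)) ∧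
      ∀ x, ∀ t : Finset ι, (∀ i, x ∈ tsupport (χ i) → i ∈ t) → ∑ i ∈ t, χ i x * θ i x = 1 := by
  have : LocallyCompactSpace M := ChartedSpace.locallyCompactSpace (EuclideanSpace ℝ (Fin d)) M
  obtain ⟨ι, f, hf⟩ := SmoothBumpCovering.exists_isSubordinate (𝓡 d) (isClosed_univ (X := M))
    (U := U) (fun x _ => hU x)
  have hcount : Countable ι := Set.countable_univ_iff.1
    (f.locallyFinite.countable_univ fun i => (f i).nonempty_support)
  set S : M → ℝ := fun x => ∑ᶠ i, f i x ^ 2 with hS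
  have hlf : LocallyFinite fun i => Function.support fun x => f i x ^ 2 :=
    f.locallyFinite.subset fun i x hx => by
      contrapose! hx
      simpa using hx
  have hSs : ContMDiff (𝓡 d) 𝓘(ℝ, ℝ) ∞ S := contMDiff_finsum (fun i => (f i).contMDiff.pow 2) hlf
  have hSsum : ∀ x (t : Finset ι), (∀ i, x ∈ tsupport (f i) → i ∈ t) →
      S x = ∑ i ∈ t, f i x ^ 2 := by
    intro x t ht
    refine finsum_eq_sum_of_support_subset _ fun i hi => ht i (subset_tsupport _ ?_)
    simpa using hi
  have hfin : ∀ x, {i | x ∈ tsupport (f i)}.Finite := f.locallyFinite.closure.point_finite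
  have hSpos : ∀ x, 0 < S x := by
    intro x
    rw [hSsum x (hfin x).toFinset (by simp)]
    obtain ⟨i, hi⟩ := f.eventuallyEq_one' x trivial
    refine Finset.sum_pos' (fun _ _ => sq_nonneg _) ⟨i, ?_, ?_⟩
    · have : f i x = 1 := hi.eq_of_nhds
      simpa using subset_tsupport _ (show x ∈ Function.support (f i) by simp [this])
    · have : f i x = 1 := hi.eq_of_nhds
      simp [this]
  refine ⟨ι, hcount, f.c, fun i => f i, fun i x => f i x / S x, fun i => (f i).contMDiff,
    fun i => (f i).contMDiff.div₀ hSs fun x => (hSpos x).ne', fun i => (f i).hasCompactSupport,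
    hf, fun i => closure_mono fun x hx => ?_, f.locallyFinite.closure, fun x t ht => ?_⟩
  · contrapose! hx
    simp only [Function.mem_support, not_not] at hx ⊢
    simp [hx]
  · have h1 : ∀ i, f i x * (f i x / S x) = f i x ^ 2 / S x := fun i => by ring
    simp only [h1]
    rw [← Finset.sum_div, ← hSsum x t ht, div_self (hSpos x).ne']

/-- Extension by zero of the pullback is smooth because it vanishes off the compact image of `T ×
T'`, which lies inside the open product of chart targets. -/
theorem exists_chart_representation [IsManifold (𝓡 d) ∞ M] {κ : M × M → ℂ}
    (hκ : ContMDiff ((𝓡 d).prod (𝓡 d)) 𝓘(ℝ, ℂ) ∞ κ) {c c' : M} {T T' : Set M}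
    (hT : IsCompact T) (hT' : IsCompact T')
    (hTc : T ⊆ (chartAt (EuclideanSpace ℝ (Fin d)) c).source)
    (hTc' : T' ⊆ (chartAt (EuclideanSpace ℝ (Fin d)) c').source)
    (h0 : ∀ x y, κ (x, y) ≠ 0 → x ∈ T ∧ y ∈ T') :
    ∃ Φ : EuclideanSpace ℝ (Fin d) × EuclideanSpace ℝ (Fin d) → ℂ, ContDiff ℝ ∞ Φ ∧
      HasCompactSupport Φ ∧ ∀ x ∈ T, ∀ y ∈ T', Φ (chartAt _ c x, chartAt _ c' y) = κ (x, y) := by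
  classical
  set φ := chartAt (EuclideanSpace ℝ (Fin d)) c
  set ψ := chartAt (EuclideanSpace ℝ (Fin d)) c'
  set Φ := (φ.target ×ˢ ψ.target).indicator fun p => κ (φ.symm p.1, ψ.symm p.2) with hΦ
  have hopen : IsOpen (φ.target ×ˢ ψ.target) := φ.open_target.prod ψ.open_target
  have hC : IsCompact ((φ '' T) ×ˢ (ψ '' T')) :=
    (hT.image_of_continuousOn (φ.continuousOn.mono hTc)).prod
      (hT'.image_of_continuousOn (ψ.continuousOn.mono hTc'))
  have hsub : (φ '' T) ×ˢ (ψ '' T') ⊆ φ.target ×ˢ ψ.target := by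
    rintro ⟨_, _⟩ ⟨⟨x, hx, rfl⟩, ⟨y, hy, rfl⟩⟩
    exact ⟨φ.map_source (hTc hx), ψ.map_source (hTc' hy)⟩
  have hz : ∀ p, p ∉ (φ '' T) ×ˢ (ψ '' T') → Φ p = 0 := by
    intro p hp
    by_cases hpt : p ∈ φ.target ×ˢ ψ.target
    · rw [hΦ, Set.indicator_of_mem hpt]
      by_contra hne
      obtain ⟨h1, h2⟩ := h0 _ _ hne
      exact hp ⟨⟨_, h1, φ.right_inv hpt.1⟩, ⟨_, h2, ψ.right_inv hpt.2⟩⟩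
    · rw [hΦ, Set.indicator_of_notMem hpt]
  refine ⟨Φ, contDiff_iff_contDiffAt.2 fun p => ?_, HasCompactSupport.intro hC hz, ?_⟩
  · by_cases hp : p ∈ φ.target ×ˢ ψ.target
    · have h1 : ContMDiffOn 𝓘(ℝ, EuclideanSpace ℝ (Fin d) × EuclideanSpace ℝ (Fin d))
          ((𝓡 d).prod (𝓡 d)) ∞
          (fun p : EuclideanSpace ℝ (Fin d) × EuclideanSpace ℝ (Fin d) =>
            (φ.symm p.1, ψ.symm p.2)) (φ.target ×ˢ ψ.target) :=
        (contMDiffOn_chart_symm.comp contDiff_fst.contMDiff.contMDiffOn fun p hp => hp.1).prodMk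
          (contMDiffOn_chart_symm.comp contDiff_snd.contMDiff.contMDiffOn fun p hp => hp.2)
      have h2 := contMDiffOn_iff_contDiffOn.1 (hκ.comp_contMDiffOn h1)
      refine (h2.contDiffAt (hopen.mem_nhds hp)).congr_of_eventuallyEq ?_
      filter_upwards [hopen.mem_nhds hp] with q hq
      rw [hΦ, Set.indicator_of_mem hq]
      rfl
    · refine (contDiffAt_const (c := (0 : ℂ))).congr_of_eventuallyEq ?_
      filter_upwards [hC.isClosed.isOpen_compl.mem_nhds fun h => hp (hsub h)] with q hq
      exact hz q hq
  · intro x hx y hy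
    have hmem : (φ x, ψ y) ∈ φ.target ×ˢ ψ.target :=
      ⟨φ.map_source (hTc hx), ψ.map_source (hTc' hy)⟩
    rw [hΦ, Set.indicator_of_mem hmem]
    simp only [φ.left_inv (hTc hx), ψ.left_inv (hTc' hy)]

end Base

/-! ### Global dual families of sections -/

section Bundles

variable {d : ℕ} {M : Type u} [TopologicalSpace M] [ChartedSpace (EuclideanSpace ℝ (Fin d)) M]
  {F : Type*} [NormedAddCommGroup F] [NormedSpace ℂ F]
  {E : M → Type*} [∀ x, AddCommGroup (E x)] [∀ x, Module ℂ (E x)]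
  [TopologicalSpace (TotalSpace F E)] [∀ x, TopologicalSpace (E x)]
  [FiberBundle F E] [VectorBundle ℂ F E] [ContMDiffVectorBundle ∞ F E (𝓡 d)]

theorem isSmoothSectionOn_univ_smul {χ : M → ℝ} (hχ : ContMDiff (𝓡 d) 𝓘(ℝ, ℝ) ∞ χ) {s : Set M}
    (hs : IsOpen s) (hsupp : tsupport χ ⊆ s) {u : ∀ x, E x} (hu : IsSmoothSectionOn d F u s) :
    IsSmoothSectionOn d F (fun x => (χ x : ℂ) • u x) Set.univ := by
  intro x _
  have hχ' : ContMDiff (𝓡 d) 𝓘(ℝ, ℂ) ∞ fun x => (χ x : ℂ) :=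
    Complex.ofRealCLM.contDiff.contMDiff.comp hχ
  by_cases hx : x ∈ s
  · have := isSmoothSectionOn_sum_smul (F := F) (E := E) {()} (c := fun _ x => (χ x : ℂ))
      (e := fun _ => u) (s := s) (fun _ _ => hχ'.contMDiffOn) fun _ _ => hu
    simp only [Finset.sum_singleton] at this
    exact (this.contMDiffAt (hs.mem_nhds hx)).contMDiffWithinAt
  · have h0 := (Bundle.contMDiff_zeroSection (n := ∞) (IB := 𝓡 d) ℝ E (F := F)).contMDiffAt (x := x)
    refine (h0.congr_of_eventuallyEq ?_).contMDiffWithinAt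
    filter_upwards [(isClosed_tsupport χ).isOpen_compl.mem_nhds fun h => hx (hsupp h)] with y hy
    simp [image_eq_zero_of_notMem_tsupport hy, zeroSection]

variable [FiniteDimensional ℂ F]

/-- A locally finite pair of families of global sections, supported in chart domains, that is
a dual pair of frames. -/
theorem HermitianBundleMetric.exists_dual_frames [T2Space M] [SecondCountableTopology M]
    [IsManifold (𝓡 d) ∞ M] (h : HermitianBundleMetric d F E) :
    ∃ (A : Type u) (_ : Countable A) (c : A → M) (T : A → Set M) (e f : A → ∀ x, E x),
      (∀ a, IsCompact (T a)) ∧ (∀ a, T a ⊆ (chartAt (EuclideanSpace ℝ (Fin d)) (c a)).source) ∧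
      LocallyFinite T ∧ (∀ a x, x ∉ T a → e a x = 0) ∧ (∀ a x, x ∉ T a → f a x = 0) ∧
      (∀ a, IsSmoothSectionOn d F (e a) Set.univ) ∧ (∀ a, IsSmoothSectionOn d F (f a) Set.univ) ∧
      ∀ x (t : Finset A), (∀ a, x ∈ T a → a ∈ t) →
        ∀ v : E x, v = ∑ a ∈ t, h.form x (e a x) v • f a x := by
  classical
  obtain ⟨ι, hι, c, χ, θ, hχ, hθ, hcomp, hsub, hθχ, hlf, hsum⟩ :=
    exists_normalized_bumpCovering (d := d) (U := fun x : M =>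
      (chartAt (EuclideanSpace ℝ (Fin d)) x).source ∩ (trivializationAt F E x).baseSet)
    (fun x => Filter.inter_mem (chart_source_mem_nhds _ x)
      ((trivializationAt F E x).open_baseSet.mem_nhds
        (FiberBundle.mem_baseSet_trivializationAt' (F := F) (E := E) x)))
  have hbase : ∀ i, tsupport (χ i) ⊆ (trivializationAt F E (c i)).baseSet :=
    fun i => (hsub i).trans Set.inter_subset_right
  refine ⟨ι × Fin (Module.finrank ℂ F), inferInstance, fun a => c a.1, fun a => tsupport (χ a.1),
    fun a x => (χ a.1 x : ℂ) • trivFrame F (c a.1) a.2 x,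
    fun a x => (θ a.1 x : ℂ) • h.dualFrame (c a.1) a.2 x, fun a => hcomp a.1,
    fun a => (hsub a.1).trans Set.inter_subset_left, ?_, ?_, ?_, ?_, ?_, ?_⟩
  · intro x
    obtain ⟨N, hN, hfin⟩ := hlf x
    exact ⟨N, hN, (hfin.prod (Set.finite_univ (α := Fin (Module.finrank ℂ F)))).subset
      fun a ha => ⟨ha, trivial⟩⟩
  · intro a x hx
    simp [image_eq_zero_of_notMem_tsupport hx]
  · intro a x hx
    simp [image_eq_zero_of_notMem_tsupport fun hx' => hx (hθχ a.1 hx')]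
  · exact fun a => isSmoothSectionOn_univ_smul (hχ a.1) (trivializationAt F E (c a.1)).open_baseSet
      (hbase a.1) (isSmoothSectionOn_trivFrame _ _)
  · exact fun a => isSmoothSectionOn_univ_smul (hθ a.1) (trivializationAt F E (c a.1)).open_baseSet
      ((hθχ a.1).trans (hbase a.1)) (h.isSmoothSectionOn_dualFrame _ _)
  · intro x t ht v
    -- Only indices whose cutoff is active at `x` lie over a valid trivialization; the remaining
    -- elements of `t` contribute zero.
    set si := (hlf.point_finite x).toFinset with hsi
    have hmem : ∀ i, i ∈ si ↔ x ∈ tsupport (χ i) := fun i => by simp [hsi]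
    rw [← Finset.sum_subset (s₁ := si ×ˢ Finset.univ) (fun a ha => ht a ((hmem _).1
      (Finset.mem_product.1 ha).1))]
    · rw [Finset.sum_product]
      have h1 : ∀ i ∈ si, ∑ α, h.form x ((χ i x : ℂ) • trivFrame F (c i) α x) v •
          (θ i x : ℂ) • h.dualFrame (c i) α x = ((χ i x * θ i x : ℝ) : ℂ) • v := by
        intro i hi
        conv_rhs => rw [h.eq_sum_dualFrame (hbase i ((hmem i).1 hi)) v]
        rw [Finset.smul_sum]
        refine Finset.sum_congr rfl fun α _ => ?_
        rw [LinearMap.map_smulₛₗ, LinearMap.smul_apply, Complex.conj_ofReal, smul_smul, smul_smul]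
        congr 1
        push_cast
        rw [smul_eq_mul]
        ring
      rw [Finset.sum_congr rfl h1, ← Finset.sum_smul, ← Complex.ofReal_sum,
        hsum x si fun i hi => (hmem i).2 hi]
      simp
    · intro a _ ha
      have : x ∉ tsupport (χ a.1) := fun hx => ha (by simp [hmem, hx])
      simp [image_eq_zero_of_notMem_tsupport this]

end Bundles

/-! ### Proper supports -/

section Support

variable {M : Type*} [TopologicalSpace M] [T2Space M]
  {E : M → Type*} [∀ x, AddCommGroup (E x)] [∀ x, Module ℂ (E x)]

/-- A compact set meets only finitely many `T a`, so the part of the support above it lies in a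
finite union of compact blocks `T a × T a`. -/
theorem isProperlySupported_of_locallyFinite {A : Type*} {T : A → Set M}
    (hT : ∀ a, IsCompact (T a)) (hlf : LocallyFinite T) {k : BundleKernel E}
    (hk : ∀ x y, k x y ≠ 0 → ∃ a, x ∈ T a ∧ y ∈ T a) : IsProperlySupported k := by
  have hsub : kernelSupport k ⊆ ⋃ a, T a ×ˢ T a := by
    refine closure_minimal (fun p hp => ?_) (LocallyFinite.isClosed_iUnion ?_
      fun a => (hT a).isClosed.prod (hT a).isClosed)
    · obtain ⟨a, h1, h2⟩ := hk _ _ hp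
      exact Set.mem_iUnion.2 ⟨a, h1, h2⟩
    · exact (hlf.preimage_continuous continuous_fst).subset fun a p hp => hp.1
  intro C hC
  have hfin := hlf.finite_nonempty_inter_compact hC
  have hcomp : IsCompact (⋃ a ∈ {a | (T a ∩ C).Nonempty}, T a ×ˢ T a) :=
    hfin.isCompact_biUnion fun a _ => (hT a).prod (hT a)
  have hcl : IsClosed (kernelSupport k) := isClosed_closure
  constructor
  · refine hcomp.of_isClosed_subset (hcl.inter (hC.isClosed.preimage continuous_fst)) ?_
    rintro p ⟨hp, hpC⟩
    obtain ⟨a, ha⟩ := Set.mem_iUnion.1 (hsub hp)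
    exact Set.mem_iUnion₂.2 ⟨a, ⟨p.1, ha.1, hpC⟩, ha⟩
  · refine hcomp.of_isClosed_subset (hcl.inter (hC.isClosed.preimage continuous_snd)) ?_
    rintro p ⟨hp, hpC⟩
    obtain ⟨a, ha⟩ := Set.mem_iUnion.1 (hsub hp)
    exact Set.mem_iUnion₂.2 ⟨a, ⟨p.2, ha.2, hpC⟩, ha⟩

end Support

/-! ### Diagonal kernels built from a family of sections -/

section DiagonalKernel

variable {d : ℕ} {M : Type u} [TopologicalSpace M] [ChartedSpace (EuclideanSpace ℝ (Fin d)) M]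
  {F : Type*} [NormedAddCommGroup F] [NormedSpace ℂ F]
  {E : M → Type*} [∀ x, AddCommGroup (E x)] [∀ x, Module ℂ (E x)]
  [TopologicalSpace (TotalSpace F E)] [∀ x, TopologicalSpace (E x)]
  [FiberBundle F E]

/-- The kernel `∑ₐ Gₐ(x, y) eₐ(x) ⊗ ⟨eₐ(y), ·⟩`. -/
def HermitianBundleMetric.diagonalKernel (h : HermitianBundleMetric d F E) {A : Type*}
    (G : A → M → M → ℂ) (e : A → ∀ x, E x) : BundleKernel E :=
  fun x y => ∑ᶠ a, G a x y • (h.form y (e a y)).smulRight (e a x)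

theorem HermitianBundleMetric.diagonalKernel_ne_zero (h : HermitianBundleMetric d F E) {A : Type*}
    {G : A → M → M → ℂ} {e : A → ∀ x, E x} {T : A → Set M} (he : ∀ a x, x ∉ T a → e a x = 0)
    {x y : M} (hxy : h.diagonalKernel G e x y ≠ 0) : ∃ a, x ∈ T a ∧ y ∈ T a := by
  by_contra! hne
  refine hxy (finsum_eq_zero_of_forall_eq_zero fun a => ?_)
  by_cases hx : x ∈ T a
  · simp [he a y (hne a hx)]
  · ext v
    simp [he a x hx]

theorem HermitianBundleMetric.form_diagonalKernel (h : HermitianBundleMetric d F E) {A : Type*}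
    (G : A → M → M → ℂ) {e : A → ∀ x, E x} {T : A → Set M} (he : ∀ a x, x ∉ T a → e a x = 0)
    {x : M} {t : Finset A} (ht : ∀ a, x ∈ T a → a ∈ t) (y : M) (v : E x) (w : E y) :
    h.form x v (h.diagonalKernel G e x y w) =
      ∑ a ∈ t, G a x y * (h.form y (e a y) w * h.form x v (e a x)) := by
  have h1 : h.diagonalKernel G e x y =
      ∑ a ∈ t, G a x y • (h.form y (e a y)).smulRight (e a x) := by
    refine finsum_eq_sum_of_support_subset _ fun a ha => ht a ?_
    by_contra hx
    refine ha ?_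
    ext v
    simp [he a x hx]
  rw [h1]
  simp [LinearMap.sum_apply]

/-- Smoothness of `G a` is needed only on `U a × U a`: elsewhere the factors built from `e a` make
the term vanish near the point, since `T a` is closed. -/
theorem HermitianBundleMetric.isSmoothKernel_diagonalKernel [VectorBundle ℂ F E]
    [ContMDiffVectorBundle ∞ F E (𝓡 d)] [FiniteDimensional ℂ F] (h : HermitianBundleMetric d F E)
    {A : Type*} {G : A → M → M → ℂ} {e : A → ∀ x, E x} {T U : A → Set M}
    (he : ∀ a x, x ∉ T a → e a x = 0) (hT : ∀ a, IsClosed (T a)) (hTU : ∀ a, T a ⊆ U a)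
    (hU : ∀ a, IsOpen (U a)) (hlf : LocallyFinite T)
    (hes : ∀ a, IsSmoothSectionOn d F (e a) Set.univ)
    (hG : ∀ a, ContMDiffOn ((𝓡 d).prod (𝓡 d)) 𝓘(ℝ, ℂ) ∞ (fun p : M × M => G a p.1 p.2)
      (U a ×ˢ U a)) :
    IsSmoothKernel d F (h.diagonalKernel G e) := by
  refine isSmoothKernel_of_form h fun x₀ y₀ α β p hp => ?_
  obtain ⟨N, hN, hfin⟩ := hlf p.1
  set b := (trivializationAt F E x₀).baseSet ×ˢ (trivializationAt F E y₀).baseSet with hb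
  have hbo : IsOpen b :=
    (trivializationAt F E x₀).open_baseSet.prod (trivializationAt F E y₀).open_baseSet
  have hloc : ∀ q : M × M, q.1 ∈ N →
      h.form q.1 (h.dualFrame x₀ α q.1) (h.diagonalKernel G e q.1 q.2 (trivFrame F y₀ β q.2)) =
      ∑ a ∈ hfin.toFinset, G a q.1 q.2 * (h.form q.2 (e a q.2) (trivFrame F y₀ β q.2) *
        h.form q.1 (h.dualFrame x₀ α q.1) (e a q.1)) := fun q hq =>
    h.form_diagonalKernel G he (fun a ha => by simpa using ⟨q.1, ha, hq⟩) _ _ _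
  have hNp : Prod.fst ⁻¹' N ∈ nhds p := continuous_fst.continuousAt.preimage_mem_nhds hN
  refine ContMDiffWithinAt.congr_of_eventuallyEq ?_
    (Filter.mem_of_superset (mem_nhdsWithin_of_mem_nhds hNp) hloc) (hloc p (mem_of_mem_nhds hN))
  refine ContMDiffWithinAt.complex_sum _ fun a _ => ?_
  by_cases hpU : p ∈ U a ×ˢ U a
  · refine ((hG a).contMDiffAt (((hU a).prod (hU a)).mem_nhds hpU)).contMDiffWithinAt.complex_mul
      (ContMDiffWithinAt.complex_mul ?_ ?_)
    · exact ((h.contMDiffOn_form ((hes a).mono (Set.subset_univ _))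
        (isSmoothSectionOn_trivFrame y₀ β)) p.2 hp.2).comp p contMDiffWithinAt_snd
        fun q hq => hq.2
    · exact ((h.contMDiffOn_form (h.isSmoothSectionOn_dualFrame x₀ α)
        ((hes a).mono (Set.subset_univ _))) p.1 hp.1).comp p contMDiffWithinAt_fst
        fun q hq => hq.1
  · have hpT : p ∈ (T a ×ˢ T a)ᶜ := fun hpT => hpU ⟨hTU a hpT.1, hTU a hpT.2⟩
    have hz : ∀ q ∈ (T a ×ˢ T a)ᶜ, G a q.1 q.2 * (h.form q.2 (e a q.2) (trivFrame F y₀ β q.2) *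
        h.form q.1 (h.dualFrame x₀ α q.1) (e a q.1)) = 0 := by
      intro q hq
      by_cases hq1 : q.1 ∈ T a
      · simp [he a q.2 fun hq2 => hq ⟨hq1, hq2⟩]
      · simp [he a q.1 hq1]
    refine (contMDiffWithinAt_const (c := (0 : ℂ))).congr_of_eventuallyEq
      (Filter.mem_of_superset (mem_nhdsWithin_of_mem_nhds
        (((hT a).prod (hT a)).isOpen_compl.mem_nhds hpT)) hz) (hz p hpT)

/-- Exchanging the two variables shows that the quadratic form is real, so a bound on its modulus is
a bound on its value. -/
theorem IsSelfAdjointKernel.conj_integral_form [MeasurableSpace M] {μ : Measure M} [SFinite μ]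
    {h : HermitianBundleMetric d F E} {k : BundleKernel E}
    (hk : IsSelfAdjointKernel h k) (u : ∀ x, E x) :
    conj (∫ p : M × M, h.form p.1 (u p.1) (k p.1 p.2 (u p.2)) ∂μ.prod μ) =
      ∫ p : M × M, h.form p.1 (u p.1) (k p.1 p.2 (u p.2)) ∂μ.prod μ := by
  rw [← integral_conj, ← integral_prod_swap]
  simp only [Prod.fst_swap, Prod.snd_swap, h.hermitian, hk _ _ _ _]

end DiagonalKernel

/-! ### The dominating kernel -/

section Main

variable {d : ℕ} {M : Type u} [TopologicalSpace M] [T2Space M]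
  [SecondCountableTopology M] [ChartedSpace (EuclideanSpace ℝ (Fin d)) M]
  [MeasurableSpace M] [BorelSpace M]
  {μ : Measure M} [IsLocallyFiniteMeasure μ]
  {F : Type*} [NormedAddCommGroup F] [NormedSpace ℂ F] [FiniteDimensional ℂ F]
  {E : M → Type*} [∀ x, AddCommGroup (E x)] [∀ x, Module ℂ (E x)]
  [TopologicalSpace (TotalSpace F E)] [∀ x, TopologicalSpace (E x)]
  [FiberBundle F E] [VectorBundle ℂ F E] [ContMDiffVectorBundle ∞ F E (𝓡 d)]
  {h : HermitianBundleMetric d F E}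

theorem IsSmoothKernel.integrable_form {k : BundleKernel E} (hk : IsSmoothKernel d F k)
    {u : ∀ x, E x} (hu : IsSmoothSectionOn d F u Set.univ) (hc : IsCompact (closure {x | u x ≠ 0})) :
    Integrable (fun p : M × M => h.form p.1 (u p.1) (k p.1 p.2 (u p.2))) (μ.prod μ) := by
  have h1 := (hk.contMDiffOn_form h isOpen_univ isOpen_univ hu hu).continuousOn
  rw [Set.univ_prod_univ, continuousOn_univ] at h1
  refine h1.integrable_of_hasCompactSupport (HasCompactSupport.intro (hc.prod hc) fun p hp => ?_)
  by_cases hx : u p.1 = 0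
  · simp [hx]
  · by_cases hy : u p.2 = 0
    · simp [hy]
    · exact (hp ⟨subset_closure hx, subset_closure hy⟩).elim

theorem IsNonnegKernel.add {k l : BundleKernel E} (hks : IsSmoothKernel d F k)
    (hls : IsSmoothKernel d F l) (hk : IsNonnegKernel μ h k) (hl : IsNonnegKernel μ h l) :
    IsNonnegKernel μ h (k + l) := by
  intro u hu hc
  have hu' : IsSmoothSectionOn d F u Set.univ := hu.contMDiffOn
  simp only [Pi.add_apply, LinearMap.add_apply, map_add]
  rw [integral_add (hks.integrable_form hu' hc) (hls.integrable_form hu' hc)]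
  exact add_nonneg (hk u hu hc) (hl u hu hc)

theorem exists_dominating_kernel [IsManifold (𝓡 d) ∞ M] (h : HermitianBundleMetric d F E)
    {k : BundleKernel E} (hk : IsSmoothKernel d F k) (hsa : IsSelfAdjointKernel h k) :
    ∃ (K : BundleKernel E) (A : Type u) (T : A → Set M), (∀ a, IsCompact (T a)) ∧
      LocallyFinite T ∧ (∀ x y, K x y ≠ 0 → ∃ a, x ∈ T a ∧ y ∈ T a) ∧
      IsSmoothKernel d F K ∧ IsNonnegKernel μ h K ∧ IsNonnegKernel μ h (K - k) := by
  classical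
  obtain ⟨A, hA, c, T, e, f, hT, hTc, hlf, he, hf, hes, hfs, hrec⟩ := h.exists_dual_frames
  have hκ : ∀ a b, ContMDiff ((𝓡 d).prod (𝓡 d)) 𝓘(ℝ, ℂ) ∞
      fun p : M × M => h.form p.1 (f a p.1) (k p.1 p.2 (f b p.2)) := fun a b => by
    have := hk.contMDiffOn_form h isOpen_univ isOpen_univ (hfs a) (hfs b)
    rwa [Set.univ_prod_univ, contMDiffOn_univ] at this
  choose Φ hΦ hΦc hΦκ using fun a b => exists_chart_representation (hκ a b) (hT a) (hT b)
    (hTc a) (hTc b) fun x y hxy => ⟨by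
      by_contra hx; exact hxy (by simp [hf a x hx]), by
      by_contra hy; exact hxy (by simp [hf b y hy])⟩
  -- Cutting the chart off to zero outside `T a` makes it Borel measurable on all of `M`; nothing
  -- changes in the integrals, where `U a` vanishes off `T a`.
  set φ : A → M → EuclideanSpace ℝ (Fin d) := fun a =>
    (T a).indicator (chartAt (EuclideanSpace ℝ (Fin d)) (c a)) with hφ
  have hφT : ∀ a, ∀ x ∈ T a, φ a x = chartAt (EuclideanSpace ℝ (Fin d)) (c a) x :=
    fun a x hx => Set.indicator_of_mem hx _
  have hφm : ∀ a, Measurable (φ a) := fun a => by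
    have := ((chartAt (EuclideanSpace ℝ (Fin d)) (c a)).continuousOn.mono
      (hTc a)).measurable_piecewise (g := 0) continuousOn_const (hT a).measurableSet
    rwa [Set.piecewise_eq_indicator] at this
  obtain ⟨G, hG, hdom⟩ := exists_dominating_functions hΦ hΦc μ φ hφm
  -- The kernel itself uses the uncut chart, which is smooth on its source, whereas `φ a` may jump
  -- at the boundary of `T a`.
  set G' : A → M → M → ℂ := fun a x y => G a (chartAt (EuclideanSpace ℝ (Fin d)) (c a) x -
    chartAt (EuclideanSpace ℝ (Fin d)) (c a) y) with hG'
  have hKs : IsSmoothKernel d F (h.diagonalKernel G' e) := by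
    refine h.isSmoothKernel_diagonalKernel he (fun a => (hT a).isClosed) hTc
      (fun a => (chartAt _ (c a)).open_source) hlf hes fun a => ?_
    have h1 : ContMDiffOn ((𝓡 d).prod (𝓡 d)) (𝓡 d) ∞ (fun p : M × M =>
        chartAt (EuclideanSpace ℝ (Fin d)) (c a) p.1)
        ((chartAt (EuclideanSpace ℝ (Fin d)) (c a)).source ×ˢ
          (chartAt (EuclideanSpace ℝ (Fin d)) (c a)).source) :=
      contMDiffOn_chart.comp contMDiffOn_fst fun p hp => hp.1
    have h2 : ContMDiffOn ((𝓡 d).prod (𝓡 d)) (𝓡 d) ∞ (fun p : M × M =>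
        chartAt (EuclideanSpace ℝ (Fin d)) (c a) p.2)
        ((chartAt (EuclideanSpace ℝ (Fin d)) (c a)).source ×ˢ
          (chartAt (EuclideanSpace ℝ (Fin d)) (c a)).source) :=
      contMDiffOn_chart.comp contMDiffOn_snd fun p hp => hp.2
    exact (hG a).contMDiff.comp_contMDiffOn (h1.sub h2)
  have key : ∀ u : ∀ x, E x,
      ContMDiff (𝓡 d) ((𝓡 d).prod 𝓘(ℝ, F)) ∞ (fun x => TotalSpace.mk' F x (u x)) →
      IsCompact (closure {x | u x ≠ 0}) → ∃ r : ℝ,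
        ∫ p : M × M, h.form p.1 (u p.1) (h.diagonalKernel G' e p.1 p.2 (u p.2)) ∂μ.prod μ = r ∧
        ‖∫ p : M × M, h.form p.1 (u p.1) (k p.1 p.2 (u p.2)) ∂μ.prod μ‖ ≤ r := by
    intro u hu hc
    set U : A → M → ℂ := fun a x => h.form x (e a x) (u x) with hU
    have hUint : ∀ a, Integrable (U a) μ := fun a => by
      have h1 := (h.contMDiffOn_form (hes a) hu.contMDiffOn).continuousOn
      rw [continuousOn_univ] at h1
      refine h1.integrable_of_hasCompactSupport (HasCompactSupport.intro (hT a) fun x hx => ?_)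
      simp [he a x hx]
    -- Compact support of `u` leaves finitely many indices, so the sums can be interchanged with the
    -- integrals.
    set t : Finset A := (hlf.finite_nonempty_inter_compact hc).toFinset with ht
    have htmem : ∀ x, u x ≠ 0 → ∀ a, x ∈ T a → a ∈ t := fun x hx a ha => by
      simpa [ht] using ⟨x, ha, subset_closure hx⟩
    have hU0 : ∀ a x, x ∉ T a → U a x = 0 := fun a x hx => by simp [hU, he a x hx]
    have hurec : ∀ x, u x = ∑ a ∈ t, U a x • f a x := fun x => by
      by_cases hx : u x = 0
      · simp [hU, hx]
      · exact hrec x t (htmem x hx) (u x)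
    have hKeq : ∀ p : M × M, h.form p.1 (u p.1) (h.diagonalKernel G' e p.1 p.2 (u p.2)) =
        ∑ a ∈ t, conj (U a p.1) * U a p.2 * G a (φ a p.1 - φ a p.2) := by
      intro p
      by_cases hx : u p.1 = 0
      · simp [hU, hx]
      rw [h.form_diagonalKernel G' he (htmem p.1 hx)]
      refine Finset.sum_congr rfl fun a _ => ?_
      by_cases h1 : p.1 ∈ T a
      · by_cases h2 : p.2 ∈ T a
        · simp only [hG', hφT a _ h1, hφT a _ h2, hU, h.hermitian]
          ring
        · simp [hU0 a _ h2, he a _ h2]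
      · simp [hU0 a _ h1, he a _ h1]
    have hkeq : ∀ p : M × M, h.form p.1 (u p.1) (k p.1 p.2 (u p.2)) =
        ∑ a ∈ t, ∑ b ∈ t, conj (U a p.1) * U b p.2 * Φ a b (φ a p.1, φ b p.2) := by
      intro p
      conv_lhs => rw [hurec p.1, hurec p.2]
      simp only [map_sum, LinearMap.sum_apply, LinearMap.map_smulₛₗ, LinearMap.smul_apply,
        smul_eq_mul, RingHom.id_apply, Finset.mul_sum]
      rw [Finset.sum_comm]
      refine Finset.sum_congr rfl fun a _ => Finset.sum_congr rfl fun b _ => ?_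
      by_cases h1 : p.1 ∈ T a
      · by_cases h2 : p.2 ∈ T b
        · rw [hφT a _ h1, hφT b _ h2, hΦκ a b _ h1 _ h2]
          ring
        · simp [hU0 b _ h2]
      · simp [hU0 a _ h1]
    obtain ⟨hGi, hΦi, r, hr, hle⟩ := hdom U hUint t
    refine ⟨r, ?_, ?_⟩
    · simp only [hKeq]
      rw [integral_finsetSum _ fun a _ => hGi a, hr]
    · simp only [hkeq]
      rw [integral_finsetSum _ fun a _ => integrable_finsetSum _ fun b _ => hΦi a b]
      simp only [integral_finsetSum t fun b _ => hΦi _ b]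
      exact hle
  refine ⟨h.diagonalKernel G' e, A, T, hT, hlf, fun x y => h.diagonalKernel_ne_zero he, hKs,
    fun u hu hc => ?_, fun u hu hc => ?_⟩
  · obtain ⟨r, hr, hle⟩ := key u hu hc
    rw [hr, Complex.zero_le_real]
    exact (norm_nonneg _).trans hle
  · obtain ⟨r, hr, hle⟩ := key u hu hc
    have hu' : IsSmoothSectionOn d F u Set.univ := hu.contMDiffOn
    simp only [Pi.sub_apply, LinearMap.sub_apply, map_sub]
    rw [integral_sub (hKs.integrable_form hu' hc) (hk.integrable_form hu' hc), hr]
    obtain ⟨z, hz⟩ := Complex.conj_eq_iff_real.1 (hsa.conj_integral_form (μ := μ) u)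
    rw [hz, Complex.norm_real] at hle
    rw [hz, ← Complex.ofReal_sub, Complex.zero_le_real]
    exact sub_nonneg.2 ((le_abs_self z).trans hle)

end Main

end

theorem mainTheorem9 {d : ℕ} {M : Type*} [TopologicalSpace M] [T2Space M]
    [SecondCountableTopology M] [ChartedSpace (EuclideanSpace ℝ (Fin d)) M]
    [IsManifold (𝓡 d) ∞ M] [MeasurableSpace M] [BorelSpace M]
    (μ : Measure M) (hμ : IsSmoothPositiveDensity d μ)
    {F : Type*} [NormedAddCommGroup F] [NormedSpace ℂ F] [FiniteDimensional ℂ F]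
    {E : M → Type*} [∀ x, AddCommGroup (E x)] [∀ x, Module ℂ (E x)]
    [TopologicalSpace (TotalSpace F E)] [∀ x, TopologicalSpace (E x)]
    [FiberBundle F E] [VectorBundle ℂ F E] [ContMDiffVectorBundle ∞ F E (𝓡 d)]
    (h : HermitianBundleMetric d F E)
    (k : BundleKernel E) (hk : IsSmoothKernel d F k) (hsa : IsSelfAdjointKernel h k) :
    (∃ K : BundleKernel E, IsSmoothKernel d F K ∧
      IsNonnegKernel μ h K ∧ IsNonnegKernel μ h (K - k) ∧
      (IsProperlySupported k → IsProperlySupported K)) ∧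
    ∀ c : ComplexConjugation h, ∃ K : BundleKernel E, IsSmoothKernel d F K ∧
      IsNonnegKernel μ h K ∧ IsNonnegKernel μ h (K - k) ∧
      (IsProperlySupported k → IsProperlySupported K) ∧
      IsRealKernel c K := by
  have := hμ.isLocallyFiniteMeasure
  obtain ⟨K, A, T, hT, hlf, hsupp, hKs, hK, hKk⟩ := exists_dominating_kernel (μ := μ) h hk hsa
  refine ⟨⟨K, hKs, hK, hKk, fun _ => isProperlySupported_of_locallyFinite hT hlf hsupp⟩,
    fun c => ⟨K + c.conjKernel K, hKs.add h (c.isSmoothKernel_conjKernel hKs),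
      hK.add hKs (c.isSmoothKernel_conjKernel hKs) (c.isNonnegKernel_conjKernel hK), ?_,
      fun _ => isProperlySupported_of_locallyFinite hT hlf fun x y hxy => hsupp x y fun h0 => ?_,
      c.isRealKernel_add_conjKernel K⟩⟩
  -- The difference is `K - k` plus the conjugate of `K`, a sum of two nonnegative kernels.
  · rw [add_sub_right_comm]
    exact hKk.add (hKs.sub h hk) (c.isSmoothKernel_conjKernel hKs) (c.isNonnegKernel_conjKernel hK)
  · exact hxy (by simp [h0, c.conjKernel_eq_zero h0])
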